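/- Let $k$ be a field, let $H$ be a finite-dimensional Hopf algebra over $k$ that is both semisimple (as a ring) and cosemisimple (as a coalgebra it is the sum of its simple subcoalgebras), and let $R$ be an associative unital $k$-algebra. Let $H\otimes R\to R$, $h\otimes a\mapsto h\cdot a$, be a $k$-linear map with $h\cdot 1=\varepsilon(h)1$ and $h\cdot(ab)=\sum(h_1\cdot a)(h_2\cdot b)$, and let $\sigma\colon H\otimes H\to R$ be a convolution invertible $k$-linear map, such that the multiplication $$(a\# h)(b\# g)=\sum a\,(h_1\cdot b)\,\sigma(h_2,g_1)\,\#\,h_3g_2\qquad(a,b\in R,\ h,g\in H)$$ makes the vector space $R\otimes H$ (with $a\# h=a\otimes h$) an associative $k$-algebra with identity $1\#1$. This algebra is the crossed product $R\#_\sigma H$. Then (i) $R$ and $R\#_\sigma H$ have the same right global dimension; (ii) $R$ and $R\#_\sigma H$ have the same left global dimension; (iii) $R$ and $R\#_\sigma H$ have the same weak dimension. Here the left (right) global dimension of a ring is the supremum of the projective dimensions of its left (right) modules, and the weak dimension is the supremum of the flat dimensions of its left modules; all of them may be infinite. -/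

import Mathlib

open scoped TensorProduct

universe u v w

noncomputable section

/-! ### Cosemisimple coalgebras -/

section Cosemisimple

variable {k H : Type*} [Field k] [AddCommGroup H] [Module k H] [Coalgebra k H]

/-- A subspace `D` of a coalgebra with `Δ(D) ⊆ D ⊗ D`. -/
def IsSubcoalgebra (D : Submodule k H) : Prop :=
  ∀ x ∈ D, Coalgebra.comul (R := k) x ∈
    LinearMap.range (TensorProduct.map D.subtype D.subtype)

/-- A simple subcoalgebra: nonzero, with no subcoalgebras other than `0` and itself. -/
def IsSimpleSubcoalgebra (D : Submodule k H) : Prop :=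
  IsSubcoalgebra D ∧ D ≠ ⊥ ∧ ∀ E : Submodule k H, IsSubcoalgebra E → E ≤ D → E = ⊥ ∨ E = D

variable (k H) in
/-- A coalgebra is cosemisimple if it is the sum of its simple subcoalgebras,
that is, if it equals its coradical. -/
def IsCosemisimple : Prop :=
  sSup {D : Submodule k H | IsSimpleSubcoalgebra D} = ⊤

end Cosemisimple

/-! ### Crossed products -/

section Crossed

variable (k R H : Type*) [Field k] [Ring R] [Algebra k R] [Ring H] [HopfAlgebra k H]

/-- The data of a crossed product: a measuring `h · a` of `R` by `H`, and a
convolution invertible linear map `σ : H ⊗ H → R`. -/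
structure CrossedData where
  /-- the map `h ↦ a ↦ h · a` -/
  act : H →ₗ[k] R →ₗ[k] R
  /-- `h · 1 = ε(h) 1` -/
  act_one : ∀ h : H, act h 1 = algebraMap k R (Coalgebra.counit h)
  /-- `h · (a b) = ∑ (h₁ · a) (h₂ · b)` -/
  act_mul : ∀ (h : H) (a b : R), act h (a * b) =
    LinearMap.mul' k R (TensorProduct.map (act.flip a) (act.flip b) (Coalgebra.comul h))
  /-- the map `h ⊗ g ↦ σ(h, g)` -/
  σ : H ⊗[k] H →ₗ[k] R
  /-- `σ` is invertible for the convolution product of `Hom(H ⊗ H, R)` -/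
  isUnit_σ : IsUnit (WithConv.toConv σ)

namespace CrossedData

variable {k R H}
variable (D : CrossedData k R H)

/-- `h ⊗ g ↦ ∑ σ(h₁, g₁) ⊗ h₂ g₂`. -/
def cocycleMul : H ⊗[k] H →ₗ[k] R ⊗[k] H :=
  TensorProduct.map D.σ (LinearMap.mul' k H) ∘ₗ Coalgebra.comul

/-- `(h, h') ↦ (b ↦ g ↦ ∑ (h · b) σ(h'₁, g₁) ⊗ h'₂ g₂)`. -/
def actCocycleMul : H →ₗ[k] H →ₗ[k] (R →ₗ[k] H →ₗ[k] R ⊗[k] H) :=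
  LinearMap.mk₂ k
    (fun h h' => ((Algebra.lsmul k k (R ⊗[k] H)).toLinearMap ∘ₗ D.act h).compl₂
      (TensorProduct.curry D.cocycleMul h'))
    (fun _ _ _ => by ext; simp)
    (fun _ _ _ => by ext; simp)
    (fun _ _ _ => by ext; simp)
    (fun c h h' => by ext; simp [smul_comm c])

/-- `h ↦ (b ↦ g ↦ ∑ (h₁ · b) σ(h₂, g₁) ⊗ h₃ g₂)`. -/
def twist : H →ₗ[k] (R →ₗ[k] H →ₗ[k] R ⊗[k] H) :=
  TensorProduct.lift D.actCocycleMul ∘ₗ Coalgebra.comul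

/-- The multiplication
`(a # h)(b # g) = ∑ a (h₁ · b) σ(h₂, g₁) # h₃ g₂` on the vector space `R ⊗ H`. -/
def mul : R ⊗[k] H →ₗ[k] R ⊗[k] H →ₗ[k] R ⊗[k] H :=
  TensorProduct.lift (LinearMap.mk₂ k
    (fun a h => TensorProduct.lift
      ((D.twist h).compr₂ (Algebra.lsmul k k (R ⊗[k] H) a)))
    (fun _ _ _ => by ext; simp)
    (fun _ _ _ => by ext; simp)
    (fun _ _ _ => by ext; simp)
    (fun c a h => by ext; simp [smul_comm c]))

/-- The multiplication in Sweedler notation, for arbitrary representations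
`Δ(h) = ∑ h₁ ⊗ h₂`, `Δ(h₂) = ∑ h₂₁ ⊗ h₂₂` and `Δ(g) = ∑ g₁ ⊗ g₂`. -/
theorem mul_tmul {ι κ μ : Type*} (a b : R) (h g : H) (rh : Coalgebra.Repr k h ι)
    (rh₂ : ∀ i, Coalgebra.Repr k (rh.right i) κ) (rg : Coalgebra.Repr k g μ) :
    D.mul (a ⊗ₜ h) (b ⊗ₜ g) = ∑ i ∈ rh.index, ∑ j ∈ (rh₂ i).index, ∑ l ∈ rg.index,
      (a * D.act (rh.left i) b * D.σ ((rh₂ i).left j ⊗ₜ rg.left l)) ⊗ₜ[k]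
        ((rh₂ i).right j * rg.right l) := by
  have key : ∀ i, D.cocycleMul (rh.right i ⊗ₜ g) = ∑ j ∈ (rh₂ i).index, ∑ l ∈ rg.index,
      D.σ ((rh₂ i).left j ⊗ₜ rg.left l) ⊗ₜ[k] ((rh₂ i).right j * rg.right l) := by
    intro i
    simp only [cocycleMul, LinearMap.comp_apply, TensorProduct.comul_tmul, ← (rh₂ i).eq, ← rg.eq]
    simp [TensorProduct.sum_tmul, TensorProduct.tmul_sum]
    rw [Finset.sum_comm]
  simp only [mul, twist, TensorProduct.lift.tmul, LinearMap.mk₂_apply, LinearMap.compr₂_apply,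
    LinearMap.comp_apply, ← rh.eq, map_sum, LinearMap.sum_apply]
  simp [actCocycleMul, key, TensorProduct.smul_tmul', mul_assoc]

end CrossedData

/-- A crossed product `R #_σ H`: a measuring and a convolution invertible `σ` for which the
multiplication `(a # h)(b # g) = ∑ a (h₁ · b) σ(h₂, g₁) # h₃ g₂` makes `R ⊗ H` an associative
algebra with identity `1 # 1`. -/
structure CrossedSystem extends CrossedData k R H where
  mul_assoc' : ∀ x y z : R ⊗[k] H,
    toCrossedData.mul (toCrossedData.mul x y) z = toCrossedData.mul x (toCrossedData.mul y z)
  one_mul' : ∀ x : R ⊗[k] H, toCrossedData.mul (1 ⊗ₜ 1) x = x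
  mul_one' : ∀ x : R ⊗[k] H, toCrossedData.mul x (1 ⊗ₜ 1) = x

variable {k R H}

/-- The crossed product `R #_σ H`; its underlying vector space is `R ⊗ H`. -/
def CrossedProduct (_S : CrossedSystem k R H) : Type _ := R ⊗[k] H

namespace CrossedProduct

variable (S : CrossedSystem k R H)

instance : AddCommGroup (CrossedProduct S) := inferInstanceAs (AddCommGroup (R ⊗[k] H))

instance : Module k (CrossedProduct S) := inferInstanceAs (Module k (R ⊗[k] H))

instance : Ring (CrossedProduct S) where
  __ := (inferInstance : AddCommGroup (CrossedProduct S))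
  mul x y := S.mul x y
  one := (1 ⊗ₜ[k] 1 : R ⊗[k] H)
  mul_assoc := S.mul_assoc'
  one_mul := S.one_mul'
  mul_one := S.mul_one'
  left_distrib x y z := map_add (S.mul x) y z
  right_distrib x y z := LinearMap.map_add₂ S.mul x y z
  zero_mul x := LinearMap.map_zero₂ S.mul x
  mul_zero x := map_zero (S.mul x)

instance : Algebra k (CrossedProduct S) :=
  Algebra.ofModule (fun c x y => LinearMap.map_smul₂ S.mul c x y)
    (fun c x y => map_smul (S.mul x) c y)

end CrossedProduct

end Crossed

/-! ### Global dimensions -/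

section Global

variable (A : Type u) [Ring A]

/-- The left global dimension: the supremum of the projective dimensions of all left
`A`-modules. (The modules range over a universe at least as large as that of `A`.) -/
def leftGlobalDimension : WithBot ℕ∞ :=
  ⨆ M : ModuleCat.{max u w} A, CategoryTheory.projectiveDimension M

/-- The right global dimension: right `A`-modules are left modules over the opposite ring. -/
def rightGlobalDimension : WithBot ℕ∞ :=
  leftGlobalDimension.{u, w} Aᵐᵒᵖ

end Global

/-! ### Flat modules over arbitrary rings and the weak dimension -/

section Weak

open MulOpposite

section Tensor

variable (A : Type*) [Ring A]
  (N : Type*) [AddCommGroup N] [Module Aᵐᵒᵖ N] (M : Type*) [AddCommGroup M] [Module A M]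

/-- The subgroup of `N ⊗_ℤ M` generated by all `n a ⊗ m - n ⊗ a m`. -/
def balancedRelations : AddSubgroup (N ⊗[ℤ] M) :=
  AddSubgroup.closure {x | ∃ (n : N) (a : A) (m : M),
    x = (op a • n) ⊗ₜ[ℤ] m - n ⊗ₜ[ℤ] (a • m)}

/-- The tensor product `N ⊗_A M` of a right `A`-module and a left `A`-module. -/
abbrev BalancedTensor : Type _ := (N ⊗[ℤ] M) ⧸ balancedRelations A N M

variable {A N}

/-- The map `f ⊗ M : N ⊗_A M → P ⊗_A M` induced by a map `f : N → P` of right modules. -/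
def balancedMap {P : Type*} [AddCommGroup P] [Module Aᵐᵒᵖ P] (f : N →ₗ[Aᵐᵒᵖ] P) :
    BalancedTensor A N M →+ BalancedTensor A P M :=
  QuotientAddGroup.map _ _ (f.toAddMonoidHom.toIntLinearMap.rTensor M).toAddMonoidHom (by
    rw [balancedRelations, AddSubgroup.closure_le]
    rintro _ ⟨n, a, m, rfl⟩
    refine AddSubgroup.subset_closure ⟨f n, a, m, ?_⟩
    rw [map_sub, ← map_smul]
    rfl)

end Tensor

variable (A : Type u) [Ring A]

/-- A left `A`-module `M` is flat if `- ⊗_A M` preserves injective maps of right modules. -/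
def IsFlatModule (M : ModuleCat.{max u w} A) : Prop :=
  ∀ (N P : Type (max u w)) [AddCommGroup N] [AddCommGroup P] [Module Aᵐᵒᵖ N] [Module Aᵐᵒᵖ P]
    (f : N →ₗ[Aᵐᵒᵖ] P), Function.Injective f → Function.Injective (balancedMap M f)

/-- `M` has flat dimension at most `n`: there is an exact sequence
`0 → F_n → ⋯ → F_0 → M → 0` with all `F_i` flat. Recursively, `M` is flat if `n = 0`, and for
`n + 1` there is a surjection from a flat module `F_0` onto `M` whose kernel has flat dimension
at most `n`. -/
def FlatDimensionLE : ℕ → ModuleCat.{max u w} A → Prop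
  | 0, M => IsFlatModule.{u, w} A M
  | n + 1, M => ∃ (F : ModuleCat.{max u w} A) (f : F →ₗ[A] M),
      IsFlatModule.{u, w} A F ∧ Function.Surjective f ∧
        FlatDimensionLE n (ModuleCat.of A (LinearMap.ker f))

/-- The left flat dimension of `M`, the least `n` with a flat resolution of length `n`
(`⊤` if there is none). -/
def flatDimension (M : ModuleCat.{max u w} A) : ℕ∞ :=
  ⨅ (n : ℕ) (_ : FlatDimensionLE.{u, w} A n M), (n : ℕ∞)

/-- The weak dimension: the supremum of the flat dimensions of all left `A`-modules. -/
def weakDimension : ℕ∞ :=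
  ⨆ M : ModuleCat.{max u w} A, flatDimension.{u, w} A M

end Weak

end

noncomputable section

/-! ### Integrals -/

section Subcoalgebra

variable {k H : Type*} [Field k] [AddCommGroup H] [Module k H]

/-! Write A for the crossed product. The extension R ⊂ A is split as R-bimodules, separable, and
finitely generated projective over R on both sides. These properties, recorded in `FrobeniusSystem`,
already force the equalities.

Projectivity of A over R makes restriction of scalars preserve projectives. Separability gives a
Maschke argument: averaging an R-linear splitting against ∑ xᵢ ⊗ yᵢ makes it A-linear, so
restriction also reflects projectives. By dimension shifting, restriction preserves projective
dimension, so the dimension of A is at most that of R. Conversely, the bimodule retraction π makes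
each R-module M a summand of the restriction of Hom_R(A, M). The axioms are left-right symmetric
(`FrobeniusSystem.op`), which settles the other side. For the weak dimension, Lambek's theorem turns
flat dimension into injective dimension of character modules. Restriction of right modules reflects
injectives by averaging, and preserves them because A is free as a left R-module.

The system comes from two integrals. Cosemisimplicity gives l on H with l(1) = 1, and π = id ⊗ l.
Semisimplicity gives t in H with ε(t) = 1. Invertibility of σ makes the Galois map x ⊗ h ↦ ∑ x γ(h₁)
⊗ h₂ bijective, where γ(h) = 1 # h, and the preimage of 1 ⊗ t yields the separability idempotent.
The right dual basis needs l(t) ≠ 0, which is a trace computation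
(`integral_apply_integral_ne_zero`). -/

theorem range_map_subtype_mono {D E : Submodule k H} (h : D ≤ E) :
    LinearMap.range (TensorProduct.map D.subtype D.subtype) ≤
      LinearMap.range (TensorProduct.map E.subtype E.subtype) := by
  rintro _ ⟨y, rfl⟩
  refine ⟨TensorProduct.map (Submodule.inclusion h) (Submodule.inclusion h) y, ?_⟩
  rw [← LinearMap.comp_apply, ← TensorProduct.map_comp]
  rfl

variable [Coalgebra k H]

theorem IsSubcoalgebra.sup {D E : Submodule k H} (hD : IsSubcoalgebra D) (hE : IsSubcoalgebra E) :
    IsSubcoalgebra (D ⊔ E) := by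
  intro x hx
  obtain ⟨d, hd, e, he, rfl⟩ := Submodule.mem_sup.1 hx
  rw [map_add]
  exact add_mem (range_map_subtype_mono le_sup_left (hD d hd))
    (range_map_subtype_mono le_sup_right (hE e he))

theorem isSubcoalgebra_bot : IsSubcoalgebra (⊥ : Submodule k H) := by
  intro x hx
  rw [(Submodule.mem_bot k).1 hx, map_zero]
  exact zero_mem _

variable (f : H →ₗ[k] k) {D : Submodule k H}

theorem IsSubcoalgebra.rid_lTensor_comul_mem (hD : IsSubcoalgebra D) {x : H} (hx : x ∈ D) :
    TensorProduct.rid k H (f.lTensor H (Coalgebra.comul x)) ∈ D := by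
  obtain ⟨y, hy⟩ := hD x hx
  rw [← hy]
  clear hy
  induction y with
  | zero => simp
  | tmul a b => simpa using D.smul_mem _ a.2
  | add a b ha hb => simpa only [map_add] using add_mem ha hb

theorem IsSubcoalgebra.lTensor_comul_eq_zero (hD : IsSubcoalgebra D) (hf : D ≤ LinearMap.ker f)
    {x : H} (hx : x ∈ D) : f.lTensor H (Coalgebra.comul x) = 0 := by
  obtain ⟨y, hy⟩ := hD x hx
  rw [← hy]
  clear hy
  induction y with
  | zero => simp
  | tmul a b => simp [show f b = 0 from hf b.2]
  | add a b ha hb => simp only [map_add, ha, hb, add_zero]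

theorem IsSubcoalgebra.rTensor_comul_eq_zero (hD : IsSubcoalgebra D) (hf : D ≤ LinearMap.ker f)
    {x : H} (hx : x ∈ D) : f.rTensor H (Coalgebra.comul x) = 0 := by
  obtain ⟨y, hy⟩ := hD x hx
  rw [← hy]
  clear hy
  induction y with
  | zero => simp
  | tmul a b => simp [show f a = 0 from hf a.2]
  | add a b ha hb => simp only [map_add, ha, hb, add_zero]

end Subcoalgebra

section Integral

variable {k H : Type*} [Field k] [Ring H]

/-- The one-dimensional subcoalgebra spanned by the unit. -/
theorem isSubcoalgebra_span_one [Bialgebra k H] :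
    IsSubcoalgebra (Submodule.span k {(1 : H)}) := by
  intro x hx
  obtain ⟨c, rfl⟩ := Submodule.mem_span_singleton.1 hx
  have h1 : (1 : H) ∈ Submodule.span k {(1 : H)} := Submodule.mem_span_singleton_self 1
  refine ⟨c • (⟨1, h1⟩ ⊗ₜ ⟨1, h1⟩), ?_⟩
  simp [Algebra.TensorProduct.one_def]

/-- A finite-dimensional cosemisimple bialgebra has a normalized two-sided integral in its dual. -/
theorem IsCosemisimple.exists_integral [Bialgebra k H] [FiniteDimensional k H]
    (h : IsCosemisimple k H) :
    ∃ l : H →ₗ[k] k, l 1 = 1 ∧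
      (∀ x, TensorProduct.rid k H (l.lTensor H (Coalgebra.comul x)) = l x • 1) ∧
      (∀ x, TensorProduct.lid k H (l.rTensor H (Coalgebra.comul x)) = l x • 1) := by
  have h10 : (1 : H) ≠ 0 := fun h0 => by
    have := congrArg (Coalgebra.counit (R := k)) h0
    simp at this
  -- A maximal subcoalgebra avoiding 1 will turn out to be a complement of k1; the integral is the
  -- projection along it.
  obtain ⟨E, ⟨hE, h1E⟩, hmax⟩ := (wellFounded_gt (α := Submodule k H)).has_min
    {E | IsSubcoalgebra E ∧ (1 : H) ∉ E} ⟨⊥, isSubcoalgebra_bot, by simpa using h10⟩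
  obtain ⟨g, hg1, hgE⟩ := Submodule.exists_le_ker_of_notMem h1E
  let l : H →ₗ[k] k := (g 1)⁻¹ • g
  have hl1 : l 1 = 1 := by simp [l, hg1]
  have hlE : E ≤ LinearMap.ker l := fun x hx => by
    simp [l, show g x = 0 from hgE hx]
  have key : ∀ D : Submodule k H, IsSimpleSubcoalgebra D → D ≤ E ⊔ Submodule.span k {1} := by
    rintro D ⟨hD, -, hs⟩
    by_cases h1 : (1 : H) ∈ E ⊔ D
    · obtain ⟨e, he, d, hd, hed⟩ := Submodule.mem_sup.1 h1
      -- Applying (id ⊗ l)Δ to 1 = e + d kills e and fixes 1, while the image of d stays in D.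
      have h1D : (1 : H) ∈ D := by
        have h2 := hD.rid_lTensor_comul_mem l hd
        have h3 := hE.lTensor_comul_eq_zero l hlE he
        have h4 : l.lTensor H (Coalgebra.comul (R := k) (e + d)) =
          l.lTensor H (Coalgebra.comul d) := by rw [map_add, map_add, h3, zero_add]
        rw [← h4, hed] at h2
        simpa [Algebra.TensorProduct.one_def, hl1] using h2
      rcases hs _ isSubcoalgebra_span_one ((Submodule.span_singleton_le_iff_mem _ _).2 h1D)
        with h0 | h0
      · exact absurd (Submodule.span_singleton_eq_bot.1 h0) h10
      · rw [← h0]; exact le_sup_right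
    · have := hmax (E ⊔ D) ⟨hE.sup hD, h1⟩
      have h2 : E ⊔ D = E := by
        by_contra hne
        exact this (lt_of_le_of_ne le_sup_left (Ne.symm hne))
      exact (le_sup_right.trans h2.le).trans le_sup_left
  have htop : ∀ x : H, ∃ e ∈ E, ∃ c : k, e + c • 1 = x := by
    intro x
    have hx : x ∈ E ⊔ Submodule.span k {1} :=
      (sSup_le key : sSup {D : Submodule k H | IsSimpleSubcoalgebra D} ≤ _)
        (h.symm ▸ Submodule.mem_top)
    obtain ⟨e, he, y, hy, rfl⟩ := Submodule.mem_sup.1 hx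
    obtain ⟨c, rfl⟩ := Submodule.mem_span_singleton.1 hy
    exact ⟨e, he, c, rfl⟩
  refine ⟨l, hl1, fun x => ?_, fun x => ?_⟩ <;> obtain ⟨e, he, c, rfl⟩ := htop x
  · simp [hE.lTensor_comul_eq_zero l hlE he, Algebra.TensorProduct.one_def, hl1,
      show l e = 0 from hlE he]
  · simp [hE.rTensor_comul_eq_zero l hlE he, Algebra.TensorProduct.one_def, hl1,
      show l e = 0 from hlE he]

open MulOpposite in
/-- A semisimple bialgebra has a normalized right integral. -/
theorem exists_right_integral_of_isSemisimpleRing [Bialgebra k H] (h : IsSemisimpleRing H) :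
    ∃ t : H, Coalgebra.counit (R := k) t = 1 ∧
      ∀ x : H, t * x = Coalgebra.counit (R := k) x • t := by
  -- The augmentation ideal, as a right ideal; t is the component of 1 in a complementary right
  -- ideal C.
  let K : Submodule Hᵐᵒᵖ Hᵐᵒᵖ :=
    { carrier := {x | Coalgebra.counit (R := k) (unop x) = 0}
      add_mem' := fun {a b} ha hb => by
        change Coalgebra.counit (R := k) (unop a + unop b) = 0
        rw [map_add, show Coalgebra.counit (R := k) (unop a) = 0 from ha,
          show Coalgebra.counit (R := k) (unop b) = 0 from hb, add_zero]
      zero_mem' := map_zero _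
      smul_mem' := fun a b hb => by
        change Coalgebra.counit (R := k) (unop b * unop a) = 0
        rw [Bialgebra.counit_mul, show Coalgebra.counit (R := k) (unop b) = 0 from hb, zero_mul] }
  obtain ⟨C, hC⟩ := exists_isCompl K
  have h1 : (1 : Hᵐᵒᵖ) ∈ K ⊔ C := hC.sup_eq_top ▸ Submodule.mem_top
  obtain ⟨e, he, t, ht, het⟩ := Submodule.mem_sup.1 h1
  have het' : unop e + unop t = 1 := congrArg unop het
  have hε : Coalgebra.counit (R := k) (unop t) = 1 := by
    have := congrArg (Coalgebra.counit (R := k)) het'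
    rwa [map_add, show Coalgebra.counit (R := k) (unop e) = 0 from he, zero_add,
      Bialgebra.counit_one] at this
  refine ⟨unop t, hε, fun x => ?_⟩
  -- Both t x and ε(x) t lie in C, and they have the same counit.
  have hz : op x * t - op (algebraMap k H (Coalgebra.counit x)) * t ∈ K ⊓ C := by
    refine ⟨?_, C.sub_mem (C.smul_mem (op x) ht) (C.smul_mem (op _) ht)⟩
    change Coalgebra.counit (R := k) (unop t * x - unop t * algebraMap k H _) = 0
    rw [map_sub, Bialgebra.counit_mul, Bialgebra.counit_mul, Bialgebra.counit_algebraMap, sub_self]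
  rw [hC.inf_eq_bot, Submodule.mem_bot, sub_eq_zero] at hz
  have := congrArg unop hz
  rw [Algebra.smul_def, Algebra.commutes]
  exact this

/-! ### The two integrals pair nontrivially -/

section Hopf

variable [HopfAlgebra k H]

open Coalgebra HopfAlgebra

/-- By coassociativity the right side is ∑ h₁ ⊗ h₂ S(h₃), and the antipode collapses the last two
factors. -/
theorem tmul_one_eq_sum_comul_mul_antipode (h : H) :
    h ⊗ₜ[k] (1 : H) = TensorProduct.lift (LinearMap.mk₂ k
      (fun x y => (comul x : H ⊗[k] H) * (1 ⊗ₜ antipode k y))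
      (fun _ _ _ => by simp [add_mul]) (fun _ _ _ => by simp)
      (fun _ _ _ => by simp [TensorProduct.tmul_add, mul_add]) (fun _ _ _ => by simp))
      (comul h) := by
  have key : TensorProduct.lift (LinearMap.mk₂ k
      (fun x y => (comul x : H ⊗[k] H) * (1 ⊗ₜ antipode k y))
      (fun _ _ _ => by simp [add_mul]) (fun _ _ _ => by simp)
      (fun _ _ _ => by simp [TensorProduct.tmul_add, mul_add]) (fun _ _ _ => by simp)) =
      (LinearMap.mul' k H ∘ₗ (antipode k).lTensor H).lTensor H ∘ₗ
        (TensorProduct.assoc k H H H).toLinearMap ∘ₗ comul.rTensor H := by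
    ext x y
    simp only [TensorProduct.AlgebraTensorModule.curry_apply, LinearMap.restrictScalars_self,
      TensorProduct.curry_apply, TensorProduct.lift.tmul, LinearMap.mk₂_apply,
      LinearMap.comp_apply, LinearMap.rTensor_tmul, LinearEquiv.coe_coe]
    generalize (comul x : H ⊗[k] H) = X
    induction X with
    | zero => simp
    | tmul a b => simp
    | add a b ha hb => simp only [add_mul, ha, hb, TensorProduct.add_tmul, map_add]
  rw [key, LinearMap.comp_apply, LinearMap.comp_apply, LinearEquiv.coe_coe,
    coassoc_apply, ← LinearMap.comp_apply, ← LinearMap.lTensor_comp, LinearMap.comp_assoc,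
    mul_antipode_lTensor_comul, LinearMap.lTensor_comp, LinearMap.comp_apply,
    lTensor_counit_comul]
  simp

/-- Substitute h ⊗ 1 = ∑ Δ(h₁)(1 ⊗ S(h₂)) and use Δ(t)Δ(h₁) = Δ(t h₁) = ε(h₁)Δ(t). -/
theorem comul_integral_mul_tmul_one {t : H} (ht : ∀ x : H, t * x = counit (R := k) x • t) (h : H) :
    (comul t : H ⊗[k] H) * (h ⊗ₜ 1) = comul t * (1 ⊗ₜ antipode k h) := by
  have h2 : ∀ X : H ⊗[k] H, comul t * TensorProduct.lift (LinearMap.mk₂ k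
      (fun x y => (comul x : H ⊗[k] H) * (1 ⊗ₜ antipode k y))
      (fun _ _ _ => by simp [add_mul]) (fun _ _ _ => by simp)
      (fun _ _ _ => by simp [TensorProduct.tmul_add, mul_add]) (fun _ _ _ => by simp)) X =
      comul t * (1 ⊗ₜ antipode k (TensorProduct.lid k H (counit.rTensor H X))) := by
    intro X
    induction X with
    | zero => simp
    | tmul a b =>
      simp only [TensorProduct.lift.tmul, LinearMap.mk₂_apply, LinearMap.rTensor_tmul,
        TensorProduct.lid_tmul, map_smul, TensorProduct.tmul_smul, mul_smul_comm]
      rw [← mul_assoc, ← Bialgebra.comul_mul, ht, map_smul, smul_mul_assoc]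
    | add a b ha hb => simp only [map_add, mul_add, ha, hb, TensorProduct.tmul_add]
  rw [tmul_one_eq_sum_comul_mul_antipode h, h2, rTensor_counit_comul]
  simp

/-- A normalized right integral and a normalized integral of the dual pair nontrivially. -/
theorem integral_apply_integral_ne_zero [FiniteDimensional k H] {t : H}
    (hε : counit (R := k) t = 1) (ht : ∀ x : H, t * x = counit (R := k) x • t)
    {l : H →ₗ[k] k} (hl1 : l 1 = 1)
    (hl : ∀ x, TensorProduct.lid k H (l.rTensor H (comul x)) = l x • 1) : l t ≠ 0 := by
  -- `L` sends x ⊗ y to the operator h ↦ l(x S(h)) y, of trace l(x S(y)). At Δ(t) the operator is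
  -- l(t) S², whereas its trace is ε(t) l(1) = 1.
  let L : H ⊗[k] H →ₗ[k] (H →ₗ[k] H) := TensorProduct.lift (LinearMap.mk₂ k
    (fun x y => (l ∘ₗ LinearMap.mulLeft k x ∘ₗ antipode k).smulRight y)
    (fun _ _ _ => by ext; simp [add_mul, add_smul]) (fun _ _ _ => by ext; simp [smul_smul])
    (fun _ _ _ => by ext; simp) (fun _ _ _ => by ext; simp [smul_smul, mul_comm]))
  have h1 : ∀ X h, L X h = TensorProduct.lid k H (l.rTensor H (X * (antipode k h ⊗ₜ 1))) := by
    intro X h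
    induction X with
    | zero => simp
    | tmul a b => simp [L]
    | add a b ha hb => simp only [map_add, LinearMap.add_apply, add_mul, ha, hb]
  have h2 : ∀ (X : H ⊗[k] H) (s : H), TensorProduct.lid k H (l.rTensor H (X * (1 ⊗ₜ s))) =
      TensorProduct.lid k H (l.rTensor H X) * s := by
    intro X s
    induction X with
    | zero => simp
    | tmul a b => simp
    | add a b ha hb => simp only [map_add, add_mul, ha, hb]
  have h3 : ∀ X, LinearMap.trace k H (L X) =
      l (LinearMap.mul' k H ((antipode k).lTensor H X)) := by
    intro X
    induction X with
    | zero => simp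
    | tmul a b => simp [L]
    | add a b ha hb => simp only [map_add, ha, hb]
  intro h0
  have h4 : L (comul t) = 0 := by
    ext h
    rw [h1, comul_integral_mul_tmul_one ht, h2, hl, h0]
    simp
  have h5 := h3 (comul t)
  rw [h4, mul_antipode_lTensor_comul_apply, hε] at h5
  simp [hl1] at h5

end Hopf

end Integral

/-! ### The convolution action on `R ⊗ C` -/

section Convolution

variable {k R C : Type*} [Field k] [Ring R] [Algebra k R] [AddCommGroup C] [Module k C]
  [Coalgebra k C]

open Coalgebra

/-- The map `a ⊗ c ↦ ∑ a f(c₁) ⊗ c₂`. -/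
def convTwist (f : C →ₗ[k] R) : R ⊗[k] C →ₗ[k] R ⊗[k] C :=
  (LinearMap.mul' k R).rTensor C ∘ₗ (TensorProduct.assoc k R R C).symm.toLinearMap ∘ₗ
    (f.rTensor C ∘ₗ comul).lTensor R

theorem convTwist_tmul (f : C →ₗ[k] R) (a : R) (c : C) :
    convTwist f (a ⊗ₜ c) = a • f.rTensor C (comul c) := by
  simp only [convTwist, LinearMap.comp_apply, LinearMap.lTensor_tmul, LinearEquiv.coe_coe]
  generalize (comul c : C ⊗[k] C) = X
  induction X with
  | zero => simp
  | tmul x y => simp [TensorProduct.smul_tmul']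
  | add x y hx hy => simp only [map_add, TensorProduct.tmul_add, hx, hy, smul_add]

theorem convTwist_smul (f : C →ₗ[k] R) (a : R) (z : R ⊗[k] C) :
    convTwist f (a • z) = a • convTwist f z := by
  induction z with
  | zero => simp
  | tmul x y => simp [TensorProduct.smul_tmul', convTwist_tmul, mul_smul]
  | add x y hx hy => simp only [smul_add, map_add, hx, hy]

/-- Coassociativity makes twisting an anti-homomorphism on the convolution algebra, so convolution
units act bijectively. -/
theorem convTwist_convTwist (f g : C →ₗ[k] R) (z : R ⊗[k] C) :
    convTwist f (convTwist g z) =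
      convTwist (WithConv.toConv g * WithConv.toConv f).ofConv z := by
  induction z with
  | zero => simp
  | add x y hx hy => simp only [map_add, hx, hy]
  | tmul a c =>
    rw [convTwist_tmul, convTwist_tmul, convTwist_smul]
    congr 1
    have h1 : ∀ X : C ⊗[k] C, convTwist f (g.rTensor C X) =
        ((LinearMap.mul' k R ∘ₗ TensorProduct.map g f).rTensor C
          ((TensorProduct.assoc k C C C).symm (comul.lTensor C X))) := by
      intro X
      induction X with
      | zero => simp
      | add x y hx hy => simp only [map_add, hx, hy]
      | tmul x y =>
        simp only [LinearMap.rTensor_tmul, convTwist_tmul, LinearMap.lTensor_tmul]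
        generalize (comul y : C ⊗[k] C) = Y
        induction Y with
        | zero => simp
        | add x y hx hy => simp only [map_add, TensorProduct.tmul_add, hx, hy, smul_add]
        | tmul y z => simp [TensorProduct.smul_tmul']
    rw [h1, coassoc_symm_apply, LinearMap.convMul_def]
    rw [← LinearMap.comp_apply, ← LinearMap.rTensor_comp, LinearMap.comp_assoc]

theorem convTwist_one (z : R ⊗[k] C) :
    convTwist (1 : WithConv (C →ₗ[k] R)).ofConv z = z := by
  induction z with
  | zero => simp
  | add x y hx hy => simp only [map_add, hx, hy]
  | tmul a c =>
    rw [convTwist_tmul, LinearMap.convOne_def]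
    simp only [LinearMap.rTensor_comp, LinearMap.comp_apply,
      rTensor_counit_comul]
    simp [TensorProduct.smul_tmul']

theorem bijective_convTwist {f : C →ₗ[k] R} (hf : IsUnit (WithConv.toConv f)) :
    Function.Bijective (convTwist f) := by
  obtain ⟨g, h1, h2⟩ := isUnit_iff_exists.1 hf
  refine Function.bijective_iff_has_inverse.2 ⟨convTwist g.ofConv, fun z => ?_, fun z => ?_⟩
  · rw [convTwist_convTwist, WithConv.toConv_ofConv, h1, convTwist_one]
  · rw [convTwist_convTwist, WithConv.toConv_ofConv, h2, convTwist_one]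

end Convolution

/-- This is the Galois map of H itself; the antipode is the convolution inverse of the identity. -/
theorem bijective_convTwist_id {k H : Type*} [Field k] [Ring H] [HopfAlgebra k H] :
    Function.Bijective (convTwist (LinearMap.id (R := k) (M := H))) :=
  bijective_convTwist (isUnit_iff_exists.2 ⟨WithConv.toConv (HopfAlgebra.antipode k),
    LinearMap.id_mul_antipode, LinearMap.antipode_mul_id⟩)

/-! ### Crossed products as ring extensions -/

section Crossed

variable {k R H : Type*} [Field k] [Ring R] [Algebra k R] [Ring H] [HopfAlgebra k H]

open Coalgebra HopfAlgebra

namespace CrossedData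

variable (D : CrossedData k R H)

theorem twist_apply (h : H) (b : R) (g : H) : D.twist h b g =
    TensorProduct.lift ((Algebra.lsmul k k (R ⊗[k] H)).toLinearMap.compl₁₂ (D.act.flip b)
      (TensorProduct.curry D.cocycleMul |>.flip g)) (comul h) := by
  simp only [twist, LinearMap.comp_apply]
  generalize (comul h : H ⊗[k] H) = X
  induction X with
  | zero => simp
  | add x y hx hy => simp only [map_add, LinearMap.add_apply, hx, hy]
  | tmul x y => simp [actCocycleMul]

theorem mul_smul_left (a : R) (x y : R ⊗[k] H) : D.mul (a • x) y = a • D.mul x y := by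
  induction x with
  | zero => simp
  | add x x' hx hx' => simp only [smul_add, map_add, LinearMap.add_apply, hx, hx']
  | tmul b h =>
    induction y with
    | zero => simp
    | add y y' hy hy' => simp only [smul_add, map_add, hy, hy']
    | tmul c g => simp [mul, TensorProduct.smul_tmul']

theorem mul_one_tmul (h : H) (b : R) (g : H) : D.mul (1 ⊗ₜ h) (b ⊗ₜ g) = D.twist h b g := by
  simp [mul]

end CrossedData

namespace CrossedProduct

variable (S : CrossedSystem k R H)

/-- The identification of `R ⊗ H` with the crossed product. -/
def tensorEquiv : R ⊗[k] H ≃ₗ[k] CrossedProduct S := LinearEquiv.refl k _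

theorem tensorEquiv_mul (x y : R ⊗[k] H) :
    tensorEquiv S x * tensorEquiv S y = tensorEquiv S (S.mul x y) := rfl

theorem tensorEquiv_one : tensorEquiv S (1 ⊗ₜ 1) = 1 := rfl

theorem tensorEquiv_smul_mul (a : R) (x y : R ⊗[k] H) :
    tensorEquiv S (a • x) * tensorEquiv S y = tensorEquiv S (a • S.mul x y) := by
  rw [tensorEquiv_mul, CrossedData.mul_smul_left]

theorem tensorEquiv_tmul_one_mul (a : R) (x : R ⊗[k] H) :
    tensorEquiv S (a ⊗ₜ 1) * tensorEquiv S x = tensorEquiv S (a • x) := by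
  have h1 : (a ⊗ₜ[k] 1 : R ⊗[k] H) = a • (1 ⊗ₜ 1) := by simp [TensorProduct.smul_tmul']
  rw [h1, tensorEquiv_smul_mul, S.one_mul']

/-- The embedding `a ↦ a # 1`. -/
def base : R →+* CrossedProduct S where
  toFun a := tensorEquiv S (a ⊗ₜ 1)
  map_one' := rfl
  map_mul' a b := by
    rw [tensorEquiv_tmul_one_mul, TensorProduct.smul_tmul', smul_eq_mul]
  map_zero' := by rw [TensorProduct.zero_tmul, map_zero]
  map_add' a b := by rw [TensorProduct.add_tmul, map_add]

theorem base_mul (a : R) (x : R ⊗[k] H) :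
    base S a * tensorEquiv S x = tensorEquiv S (a • x) :=
  tensorEquiv_tmul_one_mul S a x

/-- The section `h ↦ 1 # h`. -/
def unitSection : H →ₗ[k] CrossedProduct S :=
  (tensorEquiv S).toLinearMap ∘ₗ TensorProduct.mk k R H 1

local notation "γ" => unitSection S

theorem unitSection_apply (h : H) : γ h = tensorEquiv S (1 ⊗ₜ h) := rfl

theorem unitSection_one : γ 1 = 1 := rfl

theorem tensorEquiv_tmul (a : R) (h : H) : tensorEquiv S (a ⊗ₜ h) = base S a * γ h := by
  rw [unitSection_apply, base_mul, TensorProduct.smul_tmul', smul_eq_mul, mul_one]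

theorem base_algebraMap (c : k) : base S (algebraMap k R c) = algebraMap k _ c := by
  rw [← mul_one (base S _), ← unitSection_one, ← tensorEquiv_tmul, Algebra.algebraMap_eq_smul_one,
    ← TensorProduct.smul_tmul', map_smul, tensorEquiv_one, ← Algebra.algebraMap_eq_smul_one]

theorem base_smul (c : k) (a : R) : base S (c • a) = c • base S a := by
  rw [Algebra.smul_def, map_mul, base_algebraMap, ← Algebra.smul_def]

theorem tensorEquiv_induction {p : CrossedProduct S → Prop} (h0 : p 0)
    (h1 : ∀ a h, p (base S a * γ h)) (h2 : ∀ x y, p x → p y → p (x + y)) (x : CrossedProduct S) :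
    p x := by
  obtain ⟨x, rfl⟩ := (tensorEquiv S).surjective x
  induction x with
  | zero => simpa using h0
  | tmul a h => rw [tensorEquiv_tmul]; exact h1 a h
  | add x y hx hy => rw [map_add]; exact h2 _ _ hx hy

/-- `γ(h) γ(g) = ∑ σ(h₁, g₁) γ(h₂ g₂)`. -/
theorem unitSection_mul_unitSection (h g : H) :
    γ h * γ g = tensorEquiv S (S.cocycleMul (h ⊗ₜ g)) := by
  rw [unitSection_apply, unitSection_apply, tensorEquiv_mul, CrossedData.mul_one_tmul,
    CrossedData.twist_apply]
  congr 1
  have h1 : ∀ X : H ⊗[k] H, TensorProduct.lift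
      ((Algebra.lsmul k k (R ⊗[k] H)).toLinearMap.compl₁₂ (S.act.flip 1)
      (TensorProduct.curry S.cocycleMul |>.flip g)) X =
      S.cocycleMul (TensorProduct.lid k H (counit.rTensor H X) ⊗ₜ g) := by
    intro X
    induction X with
    | zero => simp
    | add x y hx hy => simp only [map_add, hx, hy, TensorProduct.add_tmul]
    | tmul x y => simp [S.act_one, ← TensorProduct.smul_tmul']
  rw [h1, rTensor_counit_comul]
  simp

/-- `γ(h) b = ∑ (h₁ · b) γ(h₂)`. -/
theorem unitSection_mul_base (h : H) (b : R) :
    γ h * base S b = tensorEquiv S ((S.act.flip b).rTensor H (comul h)) := by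
  change tensorEquiv S (1 ⊗ₜ h) * tensorEquiv S (b ⊗ₜ 1) = _
  rw [tensorEquiv_mul, CrossedData.mul_one_tmul, CrossedData.twist_apply]
  congr 1
  have h2 : ∀ y, S.cocycleMul (y ⊗ₜ 1) = 1 ⊗ₜ y := by
    intro y
    apply (tensorEquiv S).injective
    rw [← unitSection_mul_unitSection, unitSection_one, mul_one, unitSection_apply]
  generalize (comul h : H ⊗[k] H) = X
  induction X with
  | zero => simp
  | add x y hx hy => simp only [map_add, hx, hy]
  | tmul x y => simp [h2, TensorProduct.smul_tmul']

/-- The coaction `a # h ↦ ∑ (a # h₁) ⊗ h₂`. -/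
def coaction : CrossedProduct S →ₗ[k] CrossedProduct S ⊗[k] H :=
  (tensorEquiv S).toLinearMap.rTensor H ∘ₗ (TensorProduct.assoc k R H H).symm.toLinearMap ∘ₗ
    comul.lTensor R ∘ₗ (tensorEquiv S).symm.toLinearMap

theorem coaction_base_mul_unitSection (a : R) (h : H) :
    coaction S (base S a * γ h) = base S a • (unitSection S).rTensor H (comul h) := by
  rw [← tensorEquiv_tmul]
  simp only [coaction, LinearMap.comp_apply, LinearEquiv.coe_coe, LinearEquiv.symm_apply_apply,
    LinearMap.lTensor_tmul]
  generalize (comul h : H ⊗[k] H) = X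
  induction X with
  | zero => simp
  | add x y hx hy => simp only [map_add, hx, hy, TensorProduct.tmul_add, smul_add]
  | tmul x y => simp [tensorEquiv_tmul, TensorProduct.smul_tmul']

theorem coaction_unitSection (h : H) :
    coaction S (γ h) = (unitSection S).rTensor H (comul h) := by
  have := coaction_base_mul_unitSection S 1 h
  rwa [map_one, one_mul, one_smul] at this

theorem coaction_base_mul (a : R) (x : CrossedProduct S) :
    coaction S (base S a * x) = base S a • coaction S x := by
  induction x using tensorEquiv_induction with
  | h0 => simp
  | h1 b h => rw [← mul_assoc, ← map_mul, coaction_base_mul_unitSection,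
      coaction_base_mul_unitSection, map_mul, mul_smul]
  | h2 x y hx hy => simp only [mul_add, map_add, hx, hy, smul_add]

theorem coaction_base (a : R) : coaction S (base S a) = base S a ⊗ₜ 1 := by
  have := coaction_base_mul_unitSection S a 1
  rw [unitSection_one, mul_one] at this
  rw [this, Bialgebra.comul_one, Algebra.TensorProduct.one_def]
  simp [unitSection_one, TensorProduct.smul_tmul']

/-- The coaction of `∑ f(c₁) # m(c₂)` is `∑ (f(c₁) # m(c₂)) ⊗ m(c₃)`. -/
theorem coaction_map_comul {C : Type*} [AddCommGroup C] [Module k C] [Coalgebra k C]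
    (f : C →ₗ[k] R) (m : C →ₗc[k] H) (c : C) :
    coaction S (tensorEquiv S (TensorProduct.map f m.toLinearMap (comul c))) =
      TensorProduct.map ((tensorEquiv S).toLinearMap ∘ₗ TensorProduct.map f m.toLinearMap ∘ₗ comul)
        m.toLinearMap (comul c) := by
  have hm : ∀ y, comul (R := k) (m y) = TensorProduct.map m.toLinearMap m.toLinearMap (comul y) :=
    fun y => (LinearMap.congr_fun m.map_comp_comul y).symm
  have h1 : ∀ X : C ⊗[k] C, coaction S (tensorEquiv S (TensorProduct.map f m.toLinearMap X)) =
      TensorProduct.map ((tensorEquiv S).toLinearMap ∘ₗ TensorProduct.map f m.toLinearMap)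
        m.toLinearMap ((TensorProduct.assoc k C C C).symm (comul.lTensor C X)) := by
    intro X
    induction X with
    | zero => simp
    | add x y hx hy => simp only [map_add, hx, hy]
    | tmul x y =>
      rw [TensorProduct.map_tmul, tensorEquiv_tmul, coaction_base_mul_unitSection,
        LinearMap.lTensor_tmul]
      change base S (f x) • (unitSection S).rTensor H (comul (m y)) = _
      rw [hm]
      generalize (comul y : C ⊗[k] C) = Y
      induction Y with
      | zero => simp
      | add x y hx hy => simp only [map_add, hx, hy, TensorProduct.tmul_add, smul_add]
      | tmul y z => simp [tensorEquiv_tmul, TensorProduct.smul_tmul']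
  rw [h1, coassoc_symm_apply, ← LinearMap.comp_apply, LinearMap.map_comp_rTensor,
    LinearMap.comp_assoc]

theorem coaction_unitSection_mul_base (h : H) (b : R) :
    coaction S (γ h * base S b) = coaction S (γ h) * (base S b ⊗ₜ 1) := by
  have h1 := coaction_map_comul S (S.act.flip b) (CoalgHom.id k H) h
  change coaction S (tensorEquiv S ((S.act.flip b).rTensor H (comul h))) = _ at h1
  rw [unitSection_mul_base, h1, coaction_unitSection]
  generalize (comul h : H ⊗[k] H) = X
  induction X with
  | zero => simp
  | add x y hx hy => simp only [map_add, hx, hy, add_mul]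
  | tmul x y =>
    simp only [TensorProduct.map_tmul, LinearMap.rTensor_tmul,
      Algebra.TensorProduct.tmul_mul_tmul, mul_one, unitSection_mul_base]
    rfl

theorem coaction_unitSection_mul_unitSection (h g : H) :
    coaction S (γ h * γ g) = coaction S (γ h) * coaction S (γ g) := by
  -- Multiplication H ⊗ H → H is a coalgebra map, so γ(h) γ(g) has the form ∑ σ(c₁) # m(c₂) with c =
  -- h ⊗ g.
  have h1 := coaction_map_comul S S.σ (Bialgebra.mulCoalgHom k H) (h ⊗ₜ g)
  change coaction S (tensorEquiv S (S.cocycleMul (h ⊗ₜ g))) =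
    TensorProduct.map ((tensorEquiv S).toLinearMap ∘ₗ S.cocycleMul) (LinearMap.mul' k H) _ at h1
  rw [unitSection_mul_unitSection, h1, coaction_unitSection, coaction_unitSection,
    TensorProduct.comul_tmul]
  generalize (comul h : H ⊗[k] H) = X
  generalize (comul g : H ⊗[k] H) = Y
  induction X with
  | zero => simp
  | add x y hx hy => simp only [map_add, hx, hy, add_mul, TensorProduct.add_tmul]
  | tmul x y =>
    induction Y with
    | zero => simp
    | add x y hx hy => simp only [map_add, hx, hy, mul_add, TensorProduct.tmul_add]
    | tmul z w => simp [unitSection_mul_unitSection]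

/-- A is an H-comodule algebra: since A is spanned by products (a # 1) γ(h), it suffices to multiply
on the right by each kind of factor. -/
theorem coaction_mul (x y : CrossedProduct S) :
    coaction S (x * y) = coaction S x * coaction S y := by
  have h1 : ∀ x b, coaction S (x * base S b) = coaction S x * (base S b ⊗ₜ 1) := by
    intro x b
    induction x using tensorEquiv_induction with
    | h0 => simp
    | h1 a h => rw [mul_assoc, coaction_base_mul, coaction_unitSection_mul_base, coaction_base_mul,
        smul_mul_assoc]
    | h2 x y hx hy => simp only [add_mul, map_add, hx, hy]
  have h2 : ∀ x h, coaction S (x * γ h) = coaction S x * coaction S (γ h) := by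
    intro x h
    induction x using tensorEquiv_induction with
    | h0 => simp
    | h1 a h => rw [mul_assoc, coaction_base_mul, coaction_unitSection_mul_unitSection,
        coaction_base_mul, smul_mul_assoc]
    | h2 x y hx hy => simp only [add_mul, map_add, hx, hy]
  induction y using tensorEquiv_induction with
  | h0 => simp
  | h1 a h => rw [← mul_assoc, h2, h1, h2, coaction_base, mul_assoc]
  | h2 x y hx hy => simp only [mul_add, map_add, hx, hy]

/-- The integral absorbs the second leg, t h₂ = ε(h₂) t. This is the source of the centrality of the
separability idempotent. -/
theorem one_tmul_integral_mul_coaction {t : H} (ht : ∀ x : H, t * x = counit (R := k) x • t)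
    (x : CrossedProduct S) : (1 ⊗ₜ t) * coaction S x = x ⊗ₜ t := by
  induction x using tensorEquiv_induction with
  | h0 => simp
  | h1 a h =>
    have h1 : ∀ X : H ⊗[k] H, (1 ⊗ₜ t) * base S a • (unitSection S).rTensor H X =
        (base S a * γ (TensorProduct.rid k H (counit.lTensor H X))) ⊗ₜ t := by
      intro X
      induction X with
      | zero => simp
      | add x y hx hy => simp only [map_add, smul_add, mul_add, hx, hy, TensorProduct.add_tmul]
      | tmul x y => simp [TensorProduct.smul_tmul', ht]
    rw [coaction_base_mul, coaction_unitSection, h1, lTensor_counit_comul]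
    simp
  | h2 x y hx hy => simp only [mul_add, map_add, hx, hy, TensorProduct.add_tmul]

/-- The Galois map `x ⊗ h ↦ ∑ x γ(h₁) ⊗ h₂` is bijective. -/
theorem bijective_convTwist_unitSection : Function.Bijective (convTwist (unitSection S)) := by
  let u : R ⊗[k] (H ⊗[k] H) ≃ₗ[k] CrossedProduct S ⊗[k] H :=
    (TensorProduct.assoc k R H H).symm ≪≫ₗ (tensorEquiv S).rTensor H
  have hu : ∀ (a : R) z, u (a • z) = base S a • u z := by
    intro a z
    induction z with
    | zero => simp
    | add x y hx hy => simp only [smul_add, map_add, hx, hy]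
    | tmul b z =>
      induction z with
      | zero => simp
      | add x y hx hy => simp only [TensorProduct.tmul_add, smul_add, map_add, hx, hy]
      | tmul g h => simp [u, TensorProduct.smul_tmul', base_mul]
  let β : H ⊗[k] H ≃ₗ[k] H ⊗[k] H := LinearEquiv.ofBijective _ bijective_convTwist_id
  have hβ : ∀ g h, β (g ⊗ₜ h) = g • (comul h : H ⊗[k] H) := fun g h => by
    simp [β, convTwist_tmul]
  have hβu : ∀ (a : R) z, β.lTensor R (a • z) = a • β.lTensor R z := by
    intro a z
    induction z with
    | zero => simp
    | add x y hx hy => simp only [smul_add, map_add, hx, hy]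
    | tmul b z => simp [TensorProduct.smul_tmul']
  -- Since ∑ γ(g) γ(h₁) ⊗ h₂ = ∑ σ(g₁, h₁) γ(g₂ h₂) ⊗ h₃, the Galois map of A is, up to `u`, the
  -- twist by σ followed by the Galois map `β` of H.
  have key : ∀ z, convTwist (unitSection S) (u z) = u (β.lTensor R (convTwist S.σ z)) := by
    intro z
    induction z with
    | zero => simp
    | add x y hx hy => simp only [map_add, hx, hy]
    | tmul a z =>
      have ha : (a ⊗ₜ z : R ⊗[k] (H ⊗[k] H)) = a • (1 ⊗ₜ z) := by
        simp [TensorProduct.smul_tmul']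
      rw [ha, hu, convTwist_smul, convTwist_smul, hβu, hu]
      congr 1
      induction z with
      | zero => simp
      | add x y hx hy =>
        simp only [TensorProduct.tmul_add, map_add] at *
        rw [hx (by simp [TensorProduct.smul_tmul']), hy (by simp [TensorProduct.smul_tmul'])]
      | tmul g h =>
        have h1 : u (1 ⊗ₜ (g ⊗ₜ h)) = γ g ⊗ₜ h := by simp [u, unitSection_apply]
        have h2 : ∀ Y, γ g • (unitSection S).rTensor H Y =
            ((tensorEquiv S).toLinearMap ∘ₗ S.cocycleMul ∘ₗ TensorProduct.mk k H H g).rTensor H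
              Y := by
          intro Y
          induction Y with
          | zero => simp
          | add x y hx hy => simp only [map_add, smul_add, hx, hy]
          | tmul x y => simp [TensorProduct.smul_tmul', unitSection_mul_unitSection]
        rw [h1, convTwist_tmul, convTwist_tmul, one_smul, h2, TensorProduct.comul_tmul]
        have h3 : S.cocycleMul ∘ₗ TensorProduct.mk k H H g =
            (TensorProduct.map S.σ (LinearMap.mul' k H) ∘ₗ
              (TensorProduct.AlgebraTensorModule.tensorTensorTensorComm k k k k H H H H).toLinearMap
              ∘ₗ TensorProduct.mk k (H ⊗[k] H) (H ⊗[k] H) (comul g)) ∘ₗ comul := by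
          ext y
          simp [CrossedData.cocycleMul]
        rw [h3, ← LinearMap.comp_assoc, LinearMap.rTensor_comp, LinearMap.comp_apply,
          ← coassoc_symm_apply]
        generalize (comul g : H ⊗[k] H) = X
        generalize (comul h : H ⊗[k] H) = Y
        induction Y with
        | zero => simp
        | add x y hx hy => simp only [map_add, hx, hy, TensorProduct.tmul_add]
        | tmul y z =>
          induction X with
          | zero => simp
          | add x y hx hy =>
            simp only [map_add, hx, hy, TensorProduct.add_tmul, LinearMap.comp_add,
              LinearMap.rTensor_add, LinearMap.add_apply]
          | tmul p q =>
            simp only [LinearMap.lTensor_tmul,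
              TensorProduct.AlgebraTensorModule.tensorTensorTensorComm_tmul,
              LinearMap.rTensor_tmul, LinearEquiv.lTensor_tmul, hβ]
            generalize (comul z : H ⊗[k] H) = Z
            induction Z with
            | zero => simp
            | add x y hx hy => simp only [map_add, hx, hy, TensorProduct.tmul_add, smul_add]
            | tmul a b => simp [u, TensorProduct.smul_tmul']
  have hc : ⇑(convTwist (unitSection S)) = u ∘ β.lTensor R ∘ convTwist S.σ ∘ u.symm := by
    ext z
    simp [← key]
  rw [hc]
  exact u.bijective.comp ((β.lTensor R).bijective.comp
    ((bijective_convTwist S.isUnit_σ).comp u.symm.bijective))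

end CrossedProduct
end Crossed

/-! ### Split separable Frobenius extensions -/

/-- A ring homomorphism `ι : R → A` with a retraction `π` of `R`-bimodules, finite dual bases
`(x, ψ)` and `(y, φ)` of `A` as a right and as a left `R`-module, such that `∑ xᵢ ⊗ yᵢ` in
`A ⊗_R A` is a separability idempotent. -/
structure FrobeniusSystem {R A : Type*} [Ring R] [Ring A] (ι : R →+* A) (I : Type*)
    [Fintype I] where
  /-- the retraction -/
  π : A →+ R
  π_base_mul : ∀ r a, π (ι r * a) = r * π a
  π_mul_base : ∀ a r, π (a * ι r) = π a * r
  π_one : π 1 = 1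
  /-- the generators as a right module -/
  x : I → A
  /-- the generators as a left module -/
  y : I → A
  /-- the left coordinates -/
  φ : I → A →+ R
  φ_base_mul : ∀ i r a, φ i (ι r * a) = r * φ i a
  sum_φ : ∀ a, ∑ i, ι (φ i a) * y i = a
  /-- the right coordinates -/
  ψ : I → A →+ R
  ψ_mul_base : ∀ i a r, ψ i (a * ι r) = ψ i a * r
  sum_ψ : ∀ a, ∑ i, x i * ι (ψ i a) = a
  sum_mul : ∑ i, x i * y i = 1
  -- Centrality a ∑ xᵢ ⊗ yᵢ = ∑ xᵢ ⊗ yᵢ a, witnessed by coefficients moved across the tensor sign,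
  -- so that A ⊗_R A need not be formed.
  exists_coeff : ∀ a, ∃ r : I → I → R, (∀ i, y i * a = ∑ j, ι (r i j) * y j) ∧
    ∀ j, ∑ i, x i * ι (r i j) = a * x j

namespace FrobeniusSystem

variable {R A : Type*} [Ring R] [Ring A] {ι : R →+* A} {I : Type*} [Fintype I]

open MulOpposite

/-- The opposite system. -/
protected def op (F : FrobeniusSystem ι I) : FrobeniusSystem (RingHom.op ι) I where
  π := AddMonoidHom.mulOp F.π
  π_base_mul r a := congrArg op (F.π_mul_base (unop a) (unop r))
  π_mul_base a r := congrArg op (F.π_base_mul (unop r) (unop a))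
  π_one := congrArg op F.π_one
  x i := op (F.y i)
  y i := op (F.x i)
  φ i := AddMonoidHom.mulOp (F.ψ i)
  φ_base_mul i r a := congrArg op (F.ψ_mul_base i (unop a) (unop r))
  sum_φ a := unop_injective <| by
    simpa using F.sum_ψ (unop a)
  ψ i := AddMonoidHom.mulOp (F.φ i)
  ψ_mul_base i a r := congrArg op (F.φ_base_mul i (unop r) (unop a))
  sum_ψ a := unop_injective <| by
    simpa using F.sum_φ (unop a)
  sum_mul := unop_injective <| by simpa using F.sum_mul
  exists_coeff a := by
    obtain ⟨r, h1, h2⟩ := F.exists_coeff (unop a)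
    exact ⟨fun i j => op (r j i), fun i => unop_injective <| by simpa using (h2 i).symm,
      fun j => unop_injective <| by simpa using (h1 j).symm⟩

end FrobeniusSystem

/-! ### The Frobenius system of a crossed product -/

namespace CrossedProduct

variable {k R H : Type*} [Field k] [Ring R] [Algebra k R] [Ring H] [HopfAlgebra k H]
  (S : CrossedSystem k R H)

open Coalgebra HopfAlgebra

/-- The map `a # h ↦ f(h) a`. -/
def contract (f : H →ₗ[k] k) : CrossedProduct S →ₗ[k] R :=
  (TensorProduct.rid k R).toLinearMap ∘ₗ f.lTensor R ∘ₗ (tensorEquiv S).symm.toLinearMap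

theorem contract_base_mul_unitSection (f : H →ₗ[k] k) (a : R) (h : H) :
    contract S f (base S a * unitSection S h) = f h • a := by
  simp [← tensorEquiv_tmul, contract]

theorem contract_base_mul (f : H →ₗ[k] k) (r : R) (x : CrossedProduct S) :
    contract S f (base S r * x) = r * contract S f x := by
  induction x using tensorEquiv_induction with
  | h0 => simp
  | h1 a h => rw [← mul_assoc, ← map_mul, contract_base_mul_unitSection,
      contract_base_mul_unitSection, mul_smul_comm]
  | h2 x y hx hy => simp only [mul_add, map_add, hx, hy]

theorem contract_base (f : H →ₗ[k] k) (a : R) : contract S f (base S a) = f 1 • a := by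
  rw [← contract_base_mul_unitSection, unitSection_one, mul_one]

/-- Not part of the measuring axioms, but forced by 1 # 1 being the identity. -/
theorem act_one_apply (b : R) : S.act 1 b = b := by
  have h1 := unitSection_mul_base S 1 b
  rw [unitSection_one, one_mul, Bialgebra.comul_one, Algebra.TensorProduct.one_def,
    LinearMap.rTensor_tmul, tensorEquiv_tmul, unitSection_one, mul_one] at h1
  have h2 := congrArg (contract S counit) h1
  rw [contract_base, contract_base, Bialgebra.counit_one, one_smul, one_smul] at h2
  exact h2.symm

/-- Since ∑ h₁ l(h₂) = l(h) 1, the product γ(h) r = ∑ (h₁ · r) γ(h₂) contracts to l(h) (1 · r) =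
l(h) r. -/
theorem contract_mul_base {l : H →ₗ[k] k}
    (hl : ∀ h, TensorProduct.rid k H (l.lTensor H (comul h)) = l h • 1)
    (x : CrossedProduct S) (r : R) : contract S l (x * base S r) = contract S l x * r := by
  induction x using tensorEquiv_induction with
  | h0 => simp
  | h1 a h =>
    have h1 : ∀ X, contract S l (tensorEquiv S ((S.act.flip r).rTensor H X)) =
        S.act (TensorProduct.rid k H (l.lTensor H X)) r := by
      intro X
      induction X with
      | zero => simp
      | add x y hx hy => simp only [map_add, LinearMap.add_apply, hx, hy]
      | tmul x y => simp [contract]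
    rw [mul_assoc, contract_base_mul, unitSection_mul_base, h1, hl, map_smul, LinearMap.smul_apply,
      act_one_apply, contract_base_mul_unitSection, mul_smul_comm, smul_mul_assoc]
  | h2 x y hx hy => simp only [add_mul, map_add, hx, hy]

theorem sum_base_contract_mul {I : Type*} [Fintype I] (b : Module.Basis I k H)
    (x : CrossedProduct S) :
    ∑ i, base S (contract S (b.coord i) x) * unitSection S (b i) = x := by
  induction x using tensorEquiv_induction with
  | h0 => simp
  | h1 a h =>
    simp only [contract_base_mul_unitSection, base_smul, smul_mul_assoc, ← mul_smul_comm]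
    rw [← Finset.mul_sum]
    simp only [← map_smul, ← map_sum]
    simp only [Module.Basis.coord_apply, b.sum_repr]
  | h2 x y hx hy => simp only [map_add, add_mul, Finset.sum_add_distrib, hx, hy]

theorem rid_lTensor_convTwist {l f : H →ₗ[k] k}
    (hl : ∀ h, TensorProduct.rid k H (l.lTensor H (comul h)) = f h • 1)
    (z : CrossedProduct S ⊗[k] H) :
    TensorProduct.rid k _ (l.lTensor _ (convTwist (unitSection S) z)) =
      TensorProduct.rid k _ (f.lTensor _ z) := by
  induction z with
  | zero => simp
  | add x y hx hy => simp only [map_add, hx, hy]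
  | tmul x h =>
    have h1 : ∀ X : H ⊗[k] H, TensorProduct.rid k (CrossedProduct S)
        (l.lTensor _ (x • (unitSection S).rTensor H X)) =
        x * unitSection S (TensorProduct.rid k H (l.lTensor H X)) := by
      intro X
      induction X with
      | zero => simp
      | add x y hx hy => simp only [map_add, smul_add, mul_add, hx, hy]
      | tmul x y => simp [TensorProduct.smul_tmul']
    rw [convTwist_tmul, h1, hl, map_smul, unitSection_one]
    simp

theorem rid_lTensor_counit_convTwist (x : CrossedProduct S) (h : H) :
    TensorProduct.rid k _ ((counit (R := k)).lTensor _ (convTwist (unitSection S) (x ⊗ₜ h))) =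
      x * unitSection S h := by
  have h1 : ∀ X : H ⊗[k] H, TensorProduct.rid k (CrossedProduct S)
      ((counit (R := k)).lTensor _ (x • (unitSection S).rTensor H X)) =
      x * unitSection S (TensorProduct.rid k H ((counit (R := k)).lTensor H X)) := by
    intro X
    induction X with
    | zero => simp
    | add x y hx hy => simp only [map_add, smul_add, mul_add, hx, hy]
    | tmul x y => simp [TensorProduct.smul_tmul']
  rw [convTwist_tmul, h1, lTensor_counit_comul]
  simp

/-- A crossed product with a semisimple and cosemisimple finite-dimensional Hopf algebra carries a
split separable Frobenius system, whose left dual basis is a basis. -/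
theorem exists_frobeniusSystem [FiniteDimensional k H] (hss : IsSemisimpleRing H)
    (hcss : IsCosemisimple k H) :
    ∃ F : FrobeniusSystem (base S) (Fin (Module.finrank k H)),
      ∀ i j, F.φ j (F.y i) = if i = j then 1 else 0 := by
  obtain ⟨l, hl1, hlr, hll⟩ := hcss.exists_integral
  obtain ⟨t, hε, ht⟩ := exists_right_integral_of_isSemisimpleRing (k := k) hss
  have hlt := integral_apply_integral_ne_zero hε ht hl1 hll
  let b := Module.finBasis k H
  obtain ⟨hinj, hsurj⟩ := bijective_convTwist_unitSection S
  -- The candidate idempotent is this preimage, with its second leg later embedded in A by γ.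
  obtain ⟨e, he⟩ := hsurj (1 ⊗ₜ t)
  obtain ⟨c, hc⟩ := TensorProduct.eq_repr_basis_right b e
  let x : Fin (Module.finrank k H) → CrossedProduct S := c
  have hx : ∑ i, x i ⊗ₜ b i = e := by
    rw [← hc, Finsupp.sum_fintype _ _ (fun i => TensorProduct.zero_tmul _ (b i))]
  let y : Fin (Module.finrank k H) → CrossedProduct S := fun i => unitSection S (b i)
  -- Apply id ⊗ ε to the Galois image 1 ⊗ t of `e`.
  have hsum : ∑ i, x i * y i = 1 := by
    have h1 := congrArg (fun z => TensorProduct.rid k _ ((counit (R := k)).lTensor _ z)) he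
    simp only [← hx, map_sum, rid_lTensor_counit_convTwist] at h1
    simpa [hε] using h1
  -- By injectivity it suffices to compare Galois images. As the coaction is multiplicative, the
  -- left side gives (1 ⊗ t) ρ(a), with ρ the coaction, and this equals a ⊗ t, the image of a e.
  have hcoeff : ∀ a, ∀ j, ∑ i, x i * base S (contract S (b.coord j) (y i * a)) = a * x j := by
    intro a
    have h1 : convTwist (unitSection S)
        (∑ j, (∑ i, x i * base S (contract S (b.coord j) (y i * a))) ⊗ₜ b j) =
        convTwist (unitSection S) (∑ j, (a * x j) ⊗ₜ b j) := by
      have h2 : convTwist (unitSection S) (∑ j, (a * x j) ⊗ₜ b j) = a ⊗ₜ t := by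
        have h3 : ∑ j, (a * x j) ⊗ₜ b j = a • e := by
          rw [← hx, Finset.smul_sum]
          simp [TensorProduct.smul_tmul']
        rw [h3, convTwist_smul, he, TensorProduct.smul_tmul', smul_eq_mul, mul_one]
      have h4 : ∀ i, ∑ j, convTwist (unitSection S)
          ((x i * base S (contract S (b.coord j) (y i * a))) ⊗ₜ b j) =
          convTwist (unitSection S) (x i ⊗ₜ b i) * coaction S a := by
        intro i
        conv_rhs => rw [convTwist_tmul, ← coaction_unitSection, smul_mul_assoc, ← coaction_mul]
        conv_rhs => rw [← sum_base_contract_mul S b (unitSection S (b i) * a)]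
        rw [map_sum, Finset.smul_sum]
        refine Finset.sum_congr rfl fun j _ => ?_
        rw [coaction_base_mul_unitSection, convTwist_tmul, smul_smul]
      rw [h2, ← one_tmul_integral_mul_coaction S ht a, ← he, ← hx, map_sum, map_sum,
        Finset.sum_mul]
      simp only [TensorProduct.sum_tmul, map_sum]
      rw [Finset.sum_comm]
      exact Finset.sum_congr rfl fun i _ => h4 i
    have h5 := hinj h1
    intro j
    have h6 := congrArg (fun z => TensorProduct.rid k _ ((b.coord j).lTensor _ z)) h5
    simpa [Finsupp.single_apply] using h6
  -- Apply id ⊗ l to the Galois image 1 ⊗ t of `e`.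
  have hπ : ∑ j, x j * base S (contract S l (y j)) = algebraMap k _ (l t) := by
    have h1 := rid_lTensor_convTwist S (l := l) (f := l) hlr e
    rw [he, ← hx] at h1
    have h2 : ∀ j, contract S l (y j) = algebraMap k R (l (b j)) := by
      intro j
      have := contract_base_mul_unitSection S l 1 (b j)
      rwa [map_one, one_mul, ← Algebra.algebraMap_eq_smul_one] at this
    simp only [h2, base_algebraMap]
    simpa [Algebra.algebraMap_eq_smul_one] using h1.symm
  refine ⟨{ π := (contract S l).toAddMonoidHom
            π_base_mul := contract_base_mul S l
            π_mul_base := contract_mul_base S hlr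
            π_one := ?_
            x := x
            y := y
            φ := fun i => (contract S (b.coord i)).toAddMonoidHom
            φ_base_mul := fun i => contract_base_mul S _
            sum_φ := sum_base_contract_mul S b
            -- By centrality ∑ xᵢ π(yᵢ a) = a ∑ xⱼ π(yⱼ) = l(t) a, so the functionals π(yᵢ ·) must
            -- be divided by l(t).
            ψ := fun i => (l t)⁻¹ •
              (contract S l ∘ₗ LinearMap.mulLeft k (y i)).toAddMonoidHom
            ψ_mul_base := fun i a r => ?_
            sum_ψ := fun a => ?_
            sum_mul := hsum
            exists_coeff := fun a => ⟨fun i j => contract S (b.coord j) (y i * a),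
              fun i => (sum_base_contract_mul S b _).symm, hcoeff a⟩ }, fun i j => ?_⟩
  · have := contract_base S l (1 : R)
    rwa [map_one, hl1, one_smul] at this
  · simp [← mul_assoc, contract_mul_base S hlr]
  · have h1 : ∀ i, contract S l (y i * a) =
        ∑ j, contract S (b.coord j) (y i * a) * contract S l (y j) := by
      intro i
      conv_lhs => rw [← sum_base_contract_mul S b (y i * a), map_sum]
      exact Finset.sum_congr rfl fun j _ => contract_base_mul S _ _ _
    have h2 : ∑ i, x i * base S (contract S l (y i * a)) = l t • a := by
      simp only [h1, map_sum, map_mul, Finset.mul_sum, ← mul_assoc]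
      rw [Finset.sum_comm]
      simp only [← Finset.sum_mul, hcoeff]
      simp only [mul_assoc]
      rw [← Finset.mul_sum, hπ, ← Algebra.commutes, Algebra.smul_def]
    have h3 : ∀ i, base S ((l t)⁻¹ • contract S l (y i * a)) =
      (l t)⁻¹ • base S (contract S l (y i * a)) := fun i => base_smul S _ _
    change ∑ i, x i * base S ((l t)⁻¹ • contract S l (y i * a)) = a
    simp only [h3, mul_smul_comm]
    rw [← Finset.smul_sum, h2, smul_smul, inv_mul_cancel₀ hlt, one_smul]
  · have := contract_base_mul_unitSection S (b.coord j) 1 (b i)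
    rw [map_one, one_mul] at this
    change contract S (b.coord j) (unitSection S (b i)) = _
    rw [this]
    simp [Finsupp.single_apply]

end CrossedProduct

/-! ### Modules over a Frobenius system -/

namespace FrobeniusSystem

variable {R A : Type*} [Ring R] [Ring A] {ι : R →+* A}

section Average

variable {I : Type*} [Fintype I] (F : FrobeniusSystem ι I)
  {M N : Type*} [AddCommGroup M] [AddCommGroup N] [Module R M] [Module R N] [Module A M]
  [Module A N]

/-- Centrality of ∑ xᵢ ⊗ yᵢ: the coefficients of yᵢ a pass through the R-linear `f` and are absorbed
by the xᵢ. -/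
theorem sum_smul_map_smul (hM : ∀ (r : R) (m : M), r • m = ι r • m)
    (hN : ∀ (r : R) (n : N), r • n = ι r • n) (f : M →ₗ[R] N) (a : A) (m : M) :
    ∑ i, F.x i • f (F.y i • a • m) = a • ∑ i, F.x i • f (F.y i • m) := by
  obtain ⟨r, h1, h2⟩ := F.exists_coeff a
  have h3 : ∀ i, F.x i • f (F.y i • a • m) = ∑ j, (F.x i * ι (r i j)) • f (F.y j • m) := by
    intro i
    simp only [smul_smul, h1, Finset.sum_smul, map_sum, Finset.smul_sum]
    refine Finset.sum_congr rfl fun j _ => ?_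
    rw [mul_smul, ← hM, map_smul, hN, smul_smul]
  simp only [h3]
  rw [Finset.sum_comm]
  simp only [← Finset.sum_smul, h2]
  simp only [Finset.smul_sum, mul_smul]

/-- The `A`-linear average `m ↦ ∑ xᵢ f(yᵢ m)` of an `R`-linear map. -/
def average (hM : ∀ (r : R) (m : M), r • m = ι r • m)
    (hN : ∀ (r : R) (n : N), r • n = ι r • n) (f : M →ₗ[R] N) : M →ₗ[A] N where
  toFun m := ∑ i, F.x i • f (F.y i • m)
  map_add' m m' := by simp [Finset.sum_add_distrib]
  map_smul' a m := F.sum_smul_map_smul hM hN f a m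

end Average

/-- An `A`-module which is projective over `R` is projective. -/
theorem projective_of_restrict {I : Type*} [Fintype I] (F : FrobeniusSystem ι I)
    {M : Type*} [AddCommGroup M] [Module R M] [Module A M]
    (hM : ∀ (r : R) (m : M), r • m = ι r • m) [Module.Projective R M] : Module.Projective A M := by
  let _ : Module R (M →₀ A) := Module.compHom _ ι
  have hP : ∀ (r : R) (p : M →₀ A), r • p = ι r • p := fun _ _ => rfl
  let p : (M →₀ A) →ₗ[A] M := Finsupp.linearCombination A id
  let pR : (M →₀ A) →ₗ[R] M :=
    { toFun := p, map_add' := map_add p, map_smul' := fun r x => by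
        rw [hP, map_smul, ← hM]; rfl }
  obtain ⟨s, hs⟩ := Module.projective_lifting_property pR LinearMap.id
    (Finsupp.linearCombination_id_surjective A M)
  -- Since p is A-linear, averaging s keeps it a section: p sends the average at m to ∑ xᵢ yᵢ m = m.
  refine Module.Projective.of_split (F.average hM hP s) p (LinearMap.ext fun m => ?_)
  have h1 : ∀ m, p (s m) = m := fun m => LinearMap.congr_fun hs m
  change p (∑ i, F.x i • s (F.y i • m)) = m
  simp only [map_sum, map_smul, h1, smul_smul]
  rw [← Finset.sum_smul, F.sum_mul, one_smul]

/-- A projective `A`-module is projective over `R`. -/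
theorem projective_restrict {I : Type*} [Fintype I] (F : FrobeniusSystem ι I)
    {M : Type*} [AddCommGroup M] [Module R M] [Module A M]
    (hM : ∀ (r : R) (m : M), r • m = ι r • m) [Module.Projective A M] : Module.Projective R M := by
  obtain ⟨s, hs⟩ := (Module.projective_def (R := A) (P := M)).1 inferInstance
  -- A dual basis of M over A and the dual basis (y, φ) of A over R combine into one of M over R.
  let q : (M × I →₀ R) →ₗ[R] M := Finsupp.linearCombination R fun p => F.y p.2 • p.1
  let j : M →ₗ[R] (M × I →₀ R) :=
    { toFun m := (s m).sum fun n a => ∑ i, Finsupp.single (n, i) (F.φ i a)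
      map_add' m m' := by
        rw [map_add, Finsupp.sum_add_index']
        · simp
        · intro n a b
          simp [Finset.sum_add_distrib]
      map_smul' r m := by
        rw [hM, map_smul, RingHom.id_apply, Finsupp.sum_smul_index' (by simp), Finsupp.smul_sum]
        simp [F.φ_base_mul, Finset.smul_sum] }
  refine Module.Projective.of_split j q (LinearMap.ext fun m => ?_)
  have h1 : ∀ n a, q (∑ i, Finsupp.single (n, i) (F.φ i a)) = a • n := by
    intro n a
    simp only [q, map_sum, Finsupp.linearCombination_single, hM, smul_smul]
    rw [← Finset.sum_smul, F.sum_φ]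
  change q ((s m).sum fun n a => ∑ i, Finsupp.single (n, i) (F.φ i a)) = m
  rw [Finsupp.sum, map_sum]
  simp only [h1]
  exact hs m

/-- An `A`-module which is injective over `R` is injective. -/
theorem injective_of_restrict {I : Type*} [Fintype I] (F : FrobeniusSystem ι I)
    {X : Type w} [AddCommGroup X] [Module R X] [Module A X]
    (hX : ∀ (r : R) (m : X), r • m = ι r • m) [hinj : Module.Injective R X] :
    Module.Injective A X where
  out N P _ _ _ _ f hf g := by
    let _ : Module R N := Module.compHom N ι
    let _ : Module R P := Module.compHom P ι
    have hN : ∀ (r : R) (n : N), r • n = ι r • n := fun _ _ => rfl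
    have hP : ∀ (r : R) (p : P), r • p = ι r • p := fun _ _ => rfl
    let fR : N →ₗ[R] P := 
      { toFun := f
        map_add' := map_add f
        map_smul' := fun r n => by rw [hN, hP, map_smul]; rfl }
    let gR : N →ₗ[R] X := 
      { toFun := g
        map_add' := map_add g
        map_smul' := fun r n => by rw [hN, hX, map_smul]; rfl }
    obtain ⟨h, hh⟩ := hinj.out fR hf gR
    have hh' : ∀ n, h (f n) = g n := hh
    -- The average still extends g, because f and g are A-linear and ∑ xᵢ yᵢ = 1.
    refine ⟨F.average hP hX h, fun n => ?_⟩
    change ∑ i, F.x i • h (F.y i • f n) = g n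
    simp only [← map_smul, hh']
    simp only [map_smul, smul_smul]
    rw [← Finset.sum_smul, F.sum_mul, one_smul]

/-- The induced module `A ⊗_R N`, realized as `N ^ I`, if the `xᵢ` form a basis of `A` as a right
`R`-module. -/
abbrev inducedModule {I : Type*} [Fintype I] [DecidableEq I] (F : FrobeniusSystem ι I)
    (hF : ∀ i j, F.ψ i (F.x j) = if i = j then 1 else 0) (N : Type*)
    [AddCommGroup N] [Module R N] : Module A (I → N) where
  smul a n i := ∑ j, F.ψ i (a * F.x j) • n j
  one_smul n := by
    ext i
    change ∑ j, F.ψ i (1 * F.x j) • n j = n i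
    simp [hF]
  mul_smul a b n := by
    ext i
    change ∑ j, F.ψ i (a * b * F.x j) • n j =
      ∑ k, F.ψ i (a * F.x k) • ∑ j, F.ψ k (b * F.x j) • n j
    have h1 : ∀ j, F.ψ i (a * b * F.x j) = ∑ k, F.ψ i (a * F.x k) * F.ψ k (b * F.x j) := by
      intro j
      conv_lhs => rw [mul_assoc, ← F.sum_ψ (b * F.x j), Finset.mul_sum, map_sum]
      simp only [← mul_assoc, F.ψ_mul_base]
    simp only [h1, Finset.sum_smul, Finset.smul_sum, mul_smul]
    rw [Finset.sum_comm]
  smul_zero a := by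
    ext i
    change ∑ j, F.ψ i (a * F.x j) • (0 : N) = 0
    simp
  smul_add a m n := by
    ext i
    change ∑ j, F.ψ i (a * F.x j) • (m j + n j) =
      ∑ j, F.ψ i (a * F.x j) • m j + ∑ j, F.ψ i (a * F.x j) • n j
    simp [Finset.sum_add_distrib]
  add_smul a b n := by
    ext i
    change ∑ j, F.ψ i ((a + b) * F.x j) • n j =
      ∑ j, F.ψ i (a * F.x j) • n j + ∑ j, F.ψ i (b * F.x j) • n j
    simp [add_mul, add_smul, Finset.sum_add_distrib]
  zero_smul n := by
    ext i
    change ∑ j, F.ψ i (0 * F.x j) • n j = 0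
    simp

/-- An injective `A`-module is injective over `R`, if `A` is free as a right `R`-module. -/
theorem injective_restrict {J : Type} [Fintype J] [DecidableEq J] (F : FrobeniusSystem ι J)
    (hF : ∀ i j, F.ψ i (F.x j) = if i = j then 1 else 0)
    {X : Type w} [AddCommGroup X] [Module R X] [Module A X]
    (hX : ∀ (r : R) (m : X), r • m = ι r • m) [hinj : Module.Injective A X] :
    Module.Injective R X where
  out N P _ _ _ _ f hf g := by
    -- Induction preserves injections here, and `J : Type` keeps the induced modules in the universe
    -- where `hinj` can extend maps.
    let _ : Module A (J → N) := F.inducedModule hF N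
    let _ : Module A (J → P) := F.inducedModule hF P
    let f' : (J → N) →ₗ[A] (J → P) :=
      { toFun := fun n i => f (n i)
        map_add' := fun m n => by ext; simp
        map_smul' := fun a n => by
          ext i
          change f (∑ j, F.ψ i (a * F.x j) • n j) = ∑ j, F.ψ i (a * F.x j) • f (n j)
          simp }
    have hf' : Function.Injective f' := fun m n h => by
      ext i
      exact hf (congrFun h i)
    let g' : (J → N) →ₗ[A] X :=
      { toFun := fun n => ∑ i, F.x i • g (n i)
        map_add' := fun m n => by simp [Finset.sum_add_distrib]
        map_smul' := fun a n => by
          change ∑ i, F.x i • g (∑ j, F.ψ i (a * F.x j) • n j) = a • ∑ i, F.x i • g (n i)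
          simp only [map_sum, map_smul, Finset.smul_sum, hX, smul_smul]
          rw [Finset.sum_comm]
          simp only [← Finset.sum_smul, F.sum_ψ] }
    obtain ⟨h, hh⟩ := hinj.out f' hf' g'
    -- The unit p ↦ 1 ⊗ p, using 1 = ∑ xᵢ ψᵢ(1).
    let e : P →+ (J → P) :=
      { toFun := fun p i => F.ψ i 1 • p
        map_zero' := by ext; simp
        map_add' := fun p q => by ext; simp }
    have he : ∀ (r : R) p, e (r • p) = ι r • e p := by
      intro r p
      ext i
      change F.ψ i 1 • r • p = ∑ j, F.ψ i (ι r * F.x j) • F.ψ j 1 • p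
      simp only [smul_smul, ← F.ψ_mul_base, ← Finset.sum_smul, ← map_sum, mul_assoc,
        ← Finset.mul_sum, F.sum_ψ, mul_one, one_mul]
    refine ⟨{ toFun := fun p => h (e p)
              map_add' := by simp
              map_smul' := fun r p => by rw [he, map_smul, hX]; rfl }, fun n => ?_⟩
    change h (e (f n)) = g n
    have h1 : e (f n) = f' (fun i => F.ψ i 1 • n) := by
      ext i
      exact (map_smul f _ _).symm
    rw [h1, hh]
    change ∑ i, F.x i • g (F.ψ i 1 • n) = g n
    simp only [map_smul, hX, smul_smul]
    rw [← Finset.sum_smul, F.sum_ψ, one_smul]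

end FrobeniusSystem

/-! ### Homological dimensions along exact functors -/

namespace CategoryTheory

universe v₁ v₂ u₁ u₂

variable {C : Type u₁} {D : Type u₂} [Category.{v₁} C] [Category.{v₂} D] [Abelian C] [Abelian D]
  (G : C ⥤ D) [G.Additive] [G.Faithful]

theorem isZero_obj_iff (X : C) : Limits.IsZero (G.obj X) ↔ Limits.IsZero X := by
  rw [Limits.IsZero.iff_id_eq_zero, Limits.IsZero.iff_id_eq_zero, ← G.map_id, ← G.map_zero,
    G.map_injective.eq_iff]

variable [Limits.PreservesFiniteLimits G] [Limits.PreservesFiniteColimits G]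

/-- Dimension shifting: the functor sends a projective presentation to one. The bounds 0 (zero
objects) and 1 (projectives) are base cases, since the shift starts at 2. -/
theorem hasProjectiveDimensionLT_obj_iff [EnoughProjectives C]
    (hG : ∀ X, Projective (G.obj X) ↔ Projective X) (n : ℕ) (X : C) :
    HasProjectiveDimensionLT (G.obj X) n ↔ HasProjectiveDimensionLT X n := by
  induction n generalizing X with
  | zero => rw [hasProjectiveDimensionLT_zero_iff_isZero, hasProjectiveDimensionLT_zero_iff_isZero,
      isZero_obj_iff]
  | succ n ih =>
    cases n with
    | zero => rw [← projective_iff_hasProjectiveDimensionLT_one,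
        ← projective_iff_hasProjectiveDimensionLT_one, hG]
    | succ n =>
      obtain ⟨p⟩ := EnoughProjectives.presentation X
      have hp := p.projective
      have h : (ShortComplex.mk _ _ (Limits.kernel.condition p.f)).ShortExact :=
        { exact := ShortComplex.exact_kernel p.f }
      have h' := h.map_of_exact G
      exact (h'.hasProjectiveDimensionLT_X₃_iff n ((hG _).2 p.projective)).trans
        ((ih _).trans (h.hasProjectiveDimensionLT_X₃_iff n p.projective).symm)

theorem hasInjectiveDimensionLT_obj_iff [EnoughInjectives C]
    (hG : ∀ X, Injective (G.obj X) ↔ Injective X) (n : ℕ) (X : C) :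
    HasInjectiveDimensionLT (G.obj X) n ↔ HasInjectiveDimensionLT X n := by
  induction n generalizing X with
  | zero => rw [hasInjectiveDimensionLT_zero_iff_isZero, hasInjectiveDimensionLT_zero_iff_isZero,
      isZero_obj_iff]
  | succ n ih =>
    cases n with
    | zero => rw [← injective_iff_hasInjectiveDimensionLT_one,
        ← injective_iff_hasInjectiveDimensionLT_one, hG]
    | succ n =>
      obtain ⟨p⟩ := EnoughInjectives.presentation X
      have hp := p.injective
      have h : (ShortComplex.mk _ _ (Limits.cokernel.condition p.f)).ShortExact :=
        { exact := ShortComplex.exact_cokernel p.f }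
      have h' := h.map_of_exact G
      exact (h'.hasInjectiveDimensionLT_X₃_iff n ((hG _).2 p.injective)).symm.trans
        ((ih _).trans (h.hasInjectiveDimensionLT_X₃_iff n p.injective))

theorem projectiveDimension_obj [EnoughProjectives C]
    (hG : ∀ X, Projective (G.obj X) ↔ Projective X) (X : C) :
    projectiveDimension (G.obj X) = projectiveDimension X := by
  simp only [projectiveDimension, hasProjectiveDimensionLT_obj_iff G hG]

end CategoryTheory

/-! ### Exactness of restriction of scalars -/

namespace ModuleCat

open CategoryTheory

variable {R A : Type*} [Ring R] [Ring A] (f : R →+* A)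

theorem restrictScalars_map_exact_of_ring (S : ShortComplex (ModuleCat.{w} A)) (h : S.Exact) :
    (S.map (ModuleCat.restrictScalars.{w} f)).Exact := by
  rw [ShortComplex.ShortExact.moduleCat_exact_iff_function_exact] at h ⊢
  exact h

instance preservesFiniteLimits_restrictScalars_of_ring :
    Limits.PreservesFiniteLimits (ModuleCat.restrictScalars.{w} f) := by
  have := ((Functor.exact_tfae (ModuleCat.restrictScalars.{w} f)).out 1 3).mp
    (restrictScalars_map_exact_of_ring f)
  exact this.1

instance preservesFiniteColimits_restrictScalars_of_ring :
    Limits.PreservesFiniteColimits (ModuleCat.restrictScalars.{w} f) := by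
  have := ((Functor.exact_tfae (ModuleCat.restrictScalars.{w} f)).out 1 3).mp
    (restrictScalars_map_exact_of_ring f)
  exact this.2

end ModuleCat

/-! ### Global dimension of a Frobenius system -/

namespace FrobeniusSystem

open CategoryTheory

section

variable {R A : Type*} [Ring R] [Ring A] {ι : R →+* A} {I : Type*} [Fintype I]

theorem projective_restrictScalars_iff (F : FrobeniusSystem ι I) [Small.{w} R] [Small.{w} A]
    (M : ModuleCat.{w} A) :
    Projective ((ModuleCat.restrictScalars ι).obj M) ↔ Projective M := by
  constructor
  · intro h
    have h1 : Module.Projective R ((ModuleCat.restrictScalars ι).obj M) := inferInstance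
    have h2 : Module.Projective A M :=
      @projective_of_restrict _ _ _ _ _ _ _ F M _
        ((ModuleCat.restrictScalars ι).obj M).isModule _ (fun _ _ => rfl) h1
    exact ModuleCat.projective_of_categoryTheory_projective M
  · intro h
    have h1 : Module.Projective A M := inferInstance
    have h2 : Module.Projective R ((ModuleCat.restrictScalars ι).obj M) :=
      @projective_restrict _ _ _ _ _ _ _ F M _
        ((ModuleCat.restrictScalars ι).obj M).isModule _ (fun _ _ => rfl) h1
    exact ModuleCat.projective_of_categoryTheory_projective _

end

section

variable {R : Type u} {A : Type v} [Ring R] [Ring A] {ι : R →+* A} {I : Type*} [Fintype I]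
  (F : FrobeniusSystem ι I)

/-- Every `R`-module is a direct summand of a coinduced module. -/
def retractCoextendScalars (M : ModuleCat.{max v w} R) :
    Retract M ((ModuleCat.restrictScalars ι).obj ((ModuleCat.coextendScalars ι).obj M)) where
  i := ModuleCat.ofHom (Y := (ModuleCat.restrictScalars ι).obj
      ((ModuleCat.coextendScalars ι).obj M))
    { toFun := fun m => (ModuleCat.CoextendScalars.equiv ι M).symm
        { toFun := fun a => F.π a • m
          map_add' := fun a b => by rw [← add_smul]; exact congrArg (· • m) (map_add F.π a b)
          map_smul' := fun r a => by
            rw [RingHom.id_apply, smul_smul]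
            exact congrArg (· • m) (F.π_base_mul r a) }
      map_add' := fun m n => by
        apply ModuleCat.CoextendScalars.ext
        ext a
        exact smul_add _ _ _
      map_smul' := fun r m => by
        apply ModuleCat.CoextendScalars.ext
        ext a
        exact (smul_smul _ _ _).trans (congrArg (· • m) (F.π_mul_base a r).symm) }
  r := (ModuleCat.restrictCoextendScalarsAdj ι).counit.app M
  retract := by
    ext m
    change F.π 1 • m = m
    rw [F.π_one, one_smul]

end

section

variable {R : Type u} {A : Type (max u v)} [Ring R] [Ring A] {ι : R →+* A} {I : Type*} [Fintype I]

/-- Restriction preserves projective dimension, and by the retraction every R-module is a summand of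
a restricted one. The universe parameters let modules over both rings range over `max u v w`. -/
theorem leftGlobalDimension_eq (F : FrobeniusSystem ι I) :
    leftGlobalDimension.{u, max v w} R = leftGlobalDimension.{max u v, w} A := by
  have h1 : ∀ M : ModuleCat.{max u v w} A,
      projectiveDimension ((ModuleCat.restrictScalars ι).obj M) = projectiveDimension M :=
    projectiveDimension_obj _ fun M => F.projective_restrictScalars_iff M
  apply le_antisymm
  · refine iSup_le fun M => ?_
    refine ((F.retractCoextendScalars M).projectiveDimension_le).trans ?_
    rw [h1]
    exact le_iSup (fun M : ModuleCat.{max u v w} A => projectiveDimension M) _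
  · refine iSup_le fun M => ?_
    rw [← h1]
    exact le_iSup (fun M : ModuleCat.{max u v w} R => projectiveDimension M) _

theorem rightGlobalDimension_eq (F : FrobeniusSystem ι I) :
    rightGlobalDimension.{u, max v w} R = rightGlobalDimension.{max u v, w} A :=
  leftGlobalDimension_eq F.op

end

end FrobeniusSystem

/-! ### Character modules and flat dimension -/

open MulOpposite CategoryTheory

/-- The character group `Hom(M, ℚ / ℤ)` of a left `A`-module, as a right `A`-module. -/
def CharacterDual (_A : Type*) (M : Type*) [AddCommGroup M] : Type _ := CharacterModule M

namespace CharacterDual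

section Basic

variable {A : Type*} {M : Type*} [AddCommGroup M]

instance : AddCommGroup (CharacterDual A M) := inferInstanceAs (AddCommGroup (CharacterModule M))

instance : FunLike (CharacterDual A M) M (AddCircle (1 : ℚ)) :=
  inferInstanceAs (FunLike (CharacterModule M) M _)

instance : AddMonoidHomClass (CharacterDual A M) M (AddCircle (1 : ℚ)) where
  map_add f := f.map_add'
  map_zero f := f.map_zero'

@[ext]
theorem ext {c d : CharacterDual A M} (h : ∀ m, c m = d m) : c = d := DFunLike.ext _ _ h

theorem add_apply (c d : CharacterDual A M) (m : M) : (c + d) m = c m + d m := rfl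

variable [Ring A] [Module A M]

instance : SMul Aᵐᵒᵖ (CharacterDual A M) where
  smul a c := AddMonoidHom.mk' (fun m => c (unop a • m)) fun m n => by rw [smul_add, map_add]

theorem smul_apply (a : Aᵐᵒᵖ) (c : CharacterDual A M) (m : M) : (a • c) m = c (unop a • m) := rfl

instance : Module Aᵐᵒᵖ (CharacterDual A M) where
  one_smul c := by ext m; simp [smul_apply]
  mul_smul a b c := by ext m; simp [smul_apply, mul_smul]
  smul_zero a := rfl
  smul_add a c d := rfl
  add_smul a b c := by ext m; simp [smul_apply, add_apply, add_smul]
  zero_smul c := by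
    ext m
    rw [smul_apply, unop_zero, zero_smul, map_zero]
    rfl

/-- The transpose of a linear map. -/
def dual {N : Type*} [AddCommGroup N] [Module A N] (f : M →ₗ[A] N) :
    CharacterDual A N →ₗ[Aᵐᵒᵖ] CharacterDual A M where
  toFun c := AddMonoidHom.mk' (fun m => c (f m)) fun m n => by rw [map_add, map_add]
  map_add' _ _ := rfl
  map_smul' a c := by
    ext m
    exact congrArg c (map_smul f (unop a) m).symm

theorem dual_surjective {N : Type*} [AddCommGroup N] [Module A N] (f : M →ₗ[A] N)
    (hf : Function.Injective f) : Function.Surjective (dual f) := by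
  intro c
  obtain ⟨d, hd⟩ := CharacterModule.dual_surjective_of_injective f.toAddMonoidHom.toIntLinearMap
    hf (c : CharacterModule M)
  exact ⟨d, hd⟩

/-- A character of `N ⊗_A M` from a homomorphism of `N` to the character module of `M`. -/
def uncurry {N : Type*} [AddCommGroup N] [Module Aᵐᵒᵖ N] (g : N →ₗ[Aᵐᵒᵖ] CharacterDual A M) :
    BalancedTensor A N M →+ AddCircle (1 : ℚ) :=
  QuotientAddGroup.lift _ (TensorProduct.liftAddHom
    (AddMonoidHom.mk' (fun n => (show M →+ AddCircle (1 : ℚ) from g n)) fun n n' => by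
      ext m; rw [map_add]; rfl)
    fun z n m => by
      change (g (z • n)) m = (g n) (z • m)
      rw [map_zsmul, map_zsmul]
      rfl) (by
    rw [balancedRelations, AddSubgroup.closure_le]
    rintro _ ⟨n, a, m, rfl⟩
    change TensorProduct.liftAddHom _ _ _ = 0
    rw [map_sub, TensorProduct.liftAddHom_tmul, TensorProduct.liftAddHom_tmul]
    change (g (op a • n)) m - g n (a • m) = 0
    rw [map_smul, smul_apply, unop_op, sub_self])

/-- The homomorphism to the character module of `M` from a character of `N ⊗_A M`. -/
def curry {N : Type*} [AddCommGroup N] [Module Aᵐᵒᵖ N]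
    (c : BalancedTensor A N M →+ AddCircle (1 : ℚ)) : N →ₗ[Aᵐᵒᵖ] CharacterDual A M where
  toFun n := AddMonoidHom.mk' (fun m => c (QuotientAddGroup.mk (n ⊗ₜ m))) fun m m' => by
    rw [TensorProduct.tmul_add, QuotientAddGroup.mk_add, map_add]
  map_add' n n' := by
    ext m
    change c (QuotientAddGroup.mk ((n + n') ⊗ₜ m)) =
      c (QuotientAddGroup.mk (n ⊗ₜ m)) + c (QuotientAddGroup.mk (n' ⊗ₜ m))
    rw [TensorProduct.add_tmul, QuotientAddGroup.mk_add, map_add]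
  map_smul' a n := by
    ext m
    change c (QuotientAddGroup.mk ((a • n) ⊗ₜ m)) = c (QuotientAddGroup.mk (n ⊗ₜ (unop a • m)))
    congr 1
    rw [QuotientAddGroup.eq_iff_sub_mem]
    exact AddSubgroup.subset_closure ⟨n, unop a, m, rfl⟩

theorem balancedTensor_hom_ext {N : Type*} [AddCommGroup N] [Module Aᵐᵒᵖ N] {G : Type*}
    [AddCommGroup G] {c d : BalancedTensor A N M →+ G}
    (h : ∀ n m, c (QuotientAddGroup.mk (n ⊗ₜ m)) = d (QuotientAddGroup.mk (n ⊗ₜ m))) : c = d := by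
  apply QuotientAddGroup.addMonoidHom_ext
  ext z
  induction z with
  | zero => simp
  | tmul n m => exact h n m
  | add x y hx hy => rw [map_add, map_add, hx, hy]

end Basic

section Flat

variable {A : Type u} [Ring A] (M : ModuleCat.{max u w} A)

/-- Lambek: a module is flat if and only if its character module is injective. -/
theorem isFlatModule_iff_injective :
    IsFlatModule.{u, w} A M ↔ Module.Injective Aᵐᵒᵖ (CharacterDual A M) := by
  constructor
  · intro hM
    refine ⟨fun N P _ _ _ _ f hf g => ?_⟩
    -- A map N → M* is a character of N ⊗_A M, which extends along the injection into P ⊗_A M by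
    -- divisibility of ℚ/ℤ.
    obtain ⟨c, hc⟩ := CharacterModule.dual_surjective_of_injective
      (balancedMap M f).toIntLinearMap (hM N P f hf) (uncurry g)
    refine ⟨curry c, fun n => ?_⟩
    ext m
    exact congrArg (fun d : CharacterModule _ => d (QuotientAddGroup.mk (n ⊗ₜ m))) hc
  · intro hM N P _ _ _ _ f hf
    rw [injective_iff_map_eq_zero]
    intro z hz
    -- Characters separate points, and each character of N ⊗_A M factors through P ⊗_A M, where z
    -- vanishes.
    refine CharacterModule.eq_zero_of_character_apply fun c => ?_
    obtain ⟨h, hh⟩ := hM.out f hf (curry (c : BalancedTensor A N M →+ AddCircle (1 : ℚ)))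
    have h1 : (uncurry h).comp (balancedMap M f) =
        (c : BalancedTensor A N M →+ AddCircle (1 : ℚ)) := by
      apply balancedTensor_hom_ext
      intro n m
      change h (f n) m = _
      rw [hh]
      rfl
    have h2 := congrArg (fun d : BalancedTensor A N M →+ AddCircle (1 : ℚ) => d z) h1
    simp only [AddMonoidHom.comp_apply, hz, map_zero] at h2
    exact h2.symm

/-- The character module of a projective module is injective. -/
theorem injective_of_projective {P : Type*} [AddCommGroup P] [Module A P] [Module.Projective A P] :
    Module.Injective Aᵐᵒᵖ (CharacterDual A P) where
  out N N' _ _ _ _ f hf g := by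
    obtain ⟨s, hs⟩ := (Module.projective_def (R := A) (P := P)).1 inferInstance
    have h1 : ∀ p : P, ∃ c : N' →+ AddCircle (1 : ℚ), ∀ n, c (f n) = g n p := by
      intro p
      obtain ⟨c, hc⟩ := CharacterModule.dual_surjective_of_injective
        f.toAddMonoidHom.toIntLinearMap hf (AddMonoidHom.mk' (fun n => g n p) fun n n' => by
          rw [map_add]; rfl : N →+ AddCircle (1 : ℚ))
      exact ⟨c, fun n => congrArg (fun d : CharacterModule N => d n) hc⟩
    choose c hc using h1
    -- The extensions `c q` need not be compatible for different q. Writing p = ∑ a_q q through the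
    -- section s, prescribe the value of n at p as ∑ c_q(n a_q), which is linear in p and n.
    let h : N' → P → AddCircle (1 : ℚ) := fun n p => (s p).sum fun q a => c q (op a • n)
    have hadd : ∀ n p p', h n (p + p') = h n p + h n p' := by
      intro n p p'
      simp only [h, map_add]
      exact Finsupp.sum_add_index' (by simp) fun q a b => by
        rw [MulOpposite.op_add, add_smul, map_add]
    refine ⟨{ toFun := fun n => AddMonoidHom.mk' (h n) (hadd n)
              map_add' := fun n n' => ?_
              map_smul' := fun a n => ?_ }, fun n => ?_⟩
    · ext p
      change h (n + n') p = h n p + h n' p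
      simp [h, Finsupp.sum]
      rw [Finset.sum_add_distrib]
    · ext p
      change h (a • n) p = h n (unop a • p)
      simp only [h, map_smul]
      rw [Finsupp.sum_smul_index' (by simp)]
      simp [smul_smul]
    · ext p
      change h (f n) p = g n p
      have h2 : ∀ q (a : A), c q (op a • f n) = g n (a • q) := by
        intro q a
        rw [← map_smul, hc, map_smul, smul_apply, unop_op]
      simp only [h, h2]
      rw [Finsupp.sum, ← map_sum]
      exact congrArg (g n) (hs p)

/-- The character module as an object of the category of right modules. -/
abbrev obj : ModuleCat.{max u w} Aᵐᵒᵖ := ModuleCat.of Aᵐᵒᵖ (CharacterDual A M)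

variable {M} in
/-- The dual of `0 → ker f → F → M → 0`. -/
abbrev shortComplex {F : ModuleCat.{max u w} A} (f : F →ₗ[A] M) :
    ShortComplex (ModuleCat.{max u w} Aᵐᵒᵖ) where
  X₁ := obj.{u, w} M
  X₂ := obj.{u, w} F
  X₃ := obj.{u, w} (ModuleCat.of A (LinearMap.ker f))
  f := ModuleCat.ofHom (dual f)
  g := ModuleCat.ofHom (dual (LinearMap.ker f).subtype)
  zero := by
    refine ModuleCat.hom_ext (LinearMap.ext fun c => CharacterDual.ext (A := A) fun m => ?_)
    change c (f m) = 0
    rw [show f m = 0 from m.2, map_zero]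

variable {M} in
theorem shortExact {F : ModuleCat.{max u w} A} {f : F →ₗ[A] M} (hf : Function.Surjective f) :
    (shortComplex.{u, w} f).ShortExact := by
  refine ModuleCat.shortComplex_shortExact _ (fun c => ⟨fun hc => ?_, ?_⟩) ?_
    (dual_surjective _ (LinearMap.ker f).injective_subtype)
  · have hc' : f.toAddMonoidHom.ker ≤ (c : F →+ AddCircle (1 : ℚ)).ker := fun m hm =>
      congrArg (fun d : CharacterDual A (LinearMap.ker f) => d ⟨m, hm⟩) hc
    let e := QuotientAddGroup.quotientKerEquivOfSurjective f.toAddMonoidHom hf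
    let d : M →+ AddCircle (1 : ℚ) := (QuotientAddGroup.lift _ _ hc').comp e.symm.toAddMonoidHom
    refine ⟨(show CharacterDual A M from d), ?_⟩
    refine CharacterDual.ext (A := A) fun m => ?_
    change d (f m) = c m
    have h1 : e.symm (f m) = QuotientAddGroup.mk m := by
      rw [AddEquiv.symm_apply_eq]
      rfl
    change QuotientAddGroup.lift _ _ hc' (e.symm (f m)) = c m
    rw [h1]
    rfl
  · rintro ⟨d, rfl⟩
    refine CharacterDual.ext (A := A) fun m => ?_
    change d (f m) = 0
    rw [show f m = 0 from m.2, map_zero]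
  · intro c d h
    refine CharacterDual.ext (A := A) fun m => ?_
    obtain ⟨n, rfl⟩ := hf m
    exact congrArg (fun e : CharacterDual A F => e n) h

/-- Dualizing 0 → ker f → F → M → 0 with F flat gives a short exact sequence with injective middle
term, so both sides shift together; a strict bound by n + 1 means at most n. -/
theorem flatDimensionLE_iff (n : ℕ) :
    FlatDimensionLE.{u, w} A n M ↔ HasInjectiveDimensionLT (obj.{u, w} M) (n + 1) := by
  induction n generalizing M with
  | zero =>
    rw [← injective_iff_hasInjectiveDimensionLT_one, ← Module.injective_iff_injective_object]
    exact isFlatModule_iff_injective.{u, w} M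
  | succ n ih =>
    constructor
    · rintro ⟨F, f, hF, hf, hK⟩
      rw [isFlatModule_iff_injective, Module.injective_iff_injective_object] at hF
      exact ((shortExact.{u, w} hf).hasInjectiveDimensionLT_X₃_iff n hF).1 ((ih _).1 hK)
    · intro h
      have hF : Module.Injective Aᵐᵒᵖ (CharacterDual A (ModuleCat.of A (M →₀ A))) :=
        injective_of_projective (P := M →₀ A)
      have hf := Finsupp.linearCombination_id_surjective A M
      -- A free cover serves as the flat cover required by the recursion.
      refine ⟨ModuleCat.of A (M →₀ A), Finsupp.linearCombination A id,
        (isFlatModule_iff_injective.{u, w} _).2 hF, hf, (ih _).2 ?_⟩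
      exact ((shortExact.{u, w} hf).hasInjectiveDimensionLT_X₃_iff n
        ((Module.injective_iff_injective_object _ _).1 hF)).2 h

end Flat

end CharacterDual

/-! ### Weak dimension of a Frobenius system -/

namespace FrobeniusSystem

open CategoryTheory

section

variable {R A : Type*} [Ring R] [Ring A] {ι : R →+* A} {I : Type} [Fintype I] [DecidableEq I]

theorem injective_restrictScalars_iff (F : FrobeniusSystem ι I)
    (hF : ∀ i j, F.ψ i (F.x j) = if i = j then 1 else 0) (M : ModuleCat.{w} A) :
    Injective ((ModuleCat.restrictScalars ι).obj M) ↔ Injective M := by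
  constructor
  · intro h
    have h1 : Module.Injective R ((ModuleCat.restrictScalars ι).obj M) :=
      (Module.injective_iff_injective_object _ _).2 h
    have h2 : Module.Injective A M :=
      @injective_of_restrict _ _ _ _ _ _ _ F M _
        ((ModuleCat.restrictScalars ι).obj M).isModule _ (fun _ _ => rfl) h1
    exact (Module.injective_iff_injective_object _ _).1 h2
  · intro h
    have h1 : Module.Injective A M := (Module.injective_iff_injective_object _ _).2 h
    have h2 : Module.Injective R ((ModuleCat.restrictScalars ι).obj M) :=
      @injective_restrict _ _ _ _ _ _ _ _ F hF M _
        ((ModuleCat.restrictScalars ι).obj M).isModule _ (fun _ _ => rfl) h1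
    exact @Module.injective_object_of_injective_module R ((ModuleCat.restrictScalars ι).obj M) _ _
      ((ModuleCat.restrictScalars ι).obj M).isModule h2

end

section

variable {R : Type u} {A : Type (max u v)} [Ring R] [Ring A] {ι : R →+* A}

/-- Forming character modules commutes with restriction of scalars. -/
def characterDualRestrictScalars (ι : R →+* A) (M : ModuleCat.{max u v w} A) :
    CharacterDual.obj.{u, max v w} ((ModuleCat.restrictScalars ι).obj M) ≅
      (ModuleCat.restrictScalars (RingHom.op ι)).obj (CharacterDual.obj.{max u v, w} M) :=
  let Y := (ModuleCat.restrictScalars (RingHom.op ι)).obj (CharacterDual.obj.{max u v, w} M)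
  let _ : Module Rᵐᵒᵖ (CharacterDual A M) := Y.isModule
  let e : CharacterDual R ((ModuleCat.restrictScalars ι).obj M) ≃ₗ[Rᵐᵒᵖ] CharacterDual A M :=
    { toFun := fun c => c
      invFun := fun c => c
      map_add' := fun _ _ => rfl
      map_smul' := fun _ _ => rfl
      left_inv := fun _ => rfl
      right_inv := fun _ => rfl }
  e.toModuleIso

variable {I : Type} [Fintype I] [DecidableEq I]

/-- Pass to character modules, which are right modules. The left basis y of A becomes the right
basis x of the opposite system, as preservation of injectives requires. -/
theorem flatDimension_restrictScalars (F : FrobeniusSystem ι I)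
    (hF : ∀ i j, F.φ j (F.y i) = if i = j then 1 else 0) (M : ModuleCat.{max u v w} A) :
    flatDimension.{u, max v w} R ((ModuleCat.restrictScalars ι).obj M) =
      flatDimension.{max u v, w} A M := by
  have hop : ∀ i j, F.op.ψ i (F.op.x j) = if i = j then 1 else 0 := by
    intro i j
    change MulOpposite.op (F.φ i (F.y j)) = _
    rw [hF]
    simp only [eq_comm (a := j)]
    split_ifs <;> rfl
  have h1 : ∀ n, FlatDimensionLE.{u, max v w} R n ((ModuleCat.restrictScalars ι).obj M) ↔
      FlatDimensionLE.{max u v, w} A n M := by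
    intro n
    rw [CharacterDual.flatDimensionLE_iff, CharacterDual.flatDimensionLE_iff,
      ← hasInjectiveDimensionLT_obj_iff (ModuleCat.restrictScalars (RingHom.op ι))
        (fun M => F.op.injective_restrictScalars_iff hop M)]
    exact ⟨fun _ => hasInjectiveDimensionLT_of_iso (characterDualRestrictScalars ι M) _,
      fun _ => hasInjectiveDimensionLT_of_iso (characterDualRestrictScalars ι M).symm _⟩
  simp only [flatDimension, h1]

/-- Character duality turns a retract into a retract, and injective dimension does not increase
under retracts. -/
theorem flatDimension_le_of_retract {M N : ModuleCat.{max u w} R} (h : Retract M N) :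
    flatDimension.{u, w} R M ≤ flatDimension.{u, w} R N := by
  refine le_iInf₂ fun n hn => iInf₂_le n ?_
  rw [CharacterDual.flatDimensionLE_iff] at hn ⊢
  have h1 : Retract (CharacterDual.obj.{u, w} M) (CharacterDual.obj.{u, w} N) :=
    { i := ModuleCat.ofHom (CharacterDual.dual h.r.hom)
      r := ModuleCat.ofHom (CharacterDual.dual h.i.hom)
      retract := by
        refine ModuleCat.hom_ext (LinearMap.ext fun c => CharacterDual.ext (A := R) fun m => ?_)
        change c ((h.i ≫ h.r).hom m) = c m
        rw [h.retract]
        rfl }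
  exact h1.hasInjectiveDimensionLT _

theorem weakDimension_eq (F : FrobeniusSystem ι I)
    (hF : ∀ i j, F.φ j (F.y i) = if i = j then 1 else 0) :
    weakDimension.{u, max v w} R = weakDimension.{max u v, w} A := by
  apply le_antisymm
  · refine iSup_le fun M => ?_
    refine (flatDimension_le_of_retract (F.retractCoextendScalars M)).trans ?_
    rw [F.flatDimension_restrictScalars hF]
    exact le_iSup (fun M : ModuleCat.{max u v w} A => flatDimension.{max u v, w} A M) _
  · refine iSup_le fun M => ?_
    rw [← F.flatDimension_restrictScalars hF]
    exact le_iSup (fun M : ModuleCat.{max u v w} R => flatDimension.{u, max v w} R M) _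

end

end FrobeniusSystem

end

theorem theorem2p3 {k : Type*} [Field k]
    (R : Type u) [Ring R] [Algebra k R]
    (H : Type v) [Ring H] [HopfAlgebra k H] [FiniteDimensional k H]
    (hss : IsSemisimpleRing H) (hcss : IsCosemisimple k H)
    (S : CrossedSystem k R H) :
    rightGlobalDimension.{u, max v w} R =
        rightGlobalDimension.{max u v, w} (CrossedProduct S) ∧
      leftGlobalDimension.{u, max v w} R =
        leftGlobalDimension.{max u v, w} (CrossedProduct S) ∧
      weakDimension.{u, max v w} R =
        weakDimension.{max u v, w} (CrossedProduct S) := by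
  obtain ⟨F, hF⟩ := CrossedProduct.exists_frobeniusSystem S hss hcss
  exact ⟨F.rightGlobalDimension_eq, F.leftGlobalDimension_eq, F.weakDimension_eq hF⟩
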